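/- Conventions. Rings are commutative with unity, algebras are associative and unital. If $R$ is a ring, an $R$-algebra with $R$-involution $(B,\tau)$ is an $R$-algebra $B$ with an $R$-linear map $\tau:B\to B$ satisfying $\tau(xy)=\tau(y)\tau(x)$ and $\tau(\tau(x))=x$. It is called an Azumaya algebra with involution over $R$ if $B$ is Azumaya over its center $Z$, $Z$ is finite étale over $R$, and the structure map $R\to\{b\in Z:\tau(b)=b\}$ is an isomorphism. For a maximal ideal $\mathfrak m$ of $R$, put $B(\mathfrak m)=B/\mathfrak mB$ and let $\tau(\mathfrak m)$ be the $R/\mathfrak m$-involution of $B(\mathfrak m)$ induced by $\tau$. A central simple algebra $A$ of degree $n$ over a field $K$ (i.e. $\dim_K A=n^2$) with a $K$-involution $\sigma$ is of symplectic type if, over some field extension $L/K$, there is an isomorphism $A\otimes_KL\cong \mathrm M_n(L)$ under which $\sigma\otimes\mathrm{id}_L$ becomes $a\mapsto g^{-1}a^{\mathrm t}g$ for an invertible alternating matrix $g$ (i.e. $g^{\mathrm t}=-g$ with zero diagonal). Write $\mathrm{gen}_R(B,\tau)$ for the smallest cardinality of a subset of $B$ that is contained in no proper (unital) $R$-subalgebra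 of $B$ stable under $\tau$. **Proposition.** Let $R$ be a noetherian ring and let $(B,\tau)$ be an Azumaya algebra with involution over $R$. Let $d\in\{0,1,2,\dots\}\cup\{\infty\}$ be the dimension of $\operatorname{Max}R$, the set of maximal ideals of $R$ viewed as a topological subspace of $\operatorname{Spec}R$; here the dimension of a topological space is the supremum of the lengths $d$ of chains $X_0\subsetneq X_1\subsetneq\dots\subsetneq X_d$ of irreducible closed subsets. If for every maximal ideal $\mathfrak m$ of $R$ the pair $(B(\mathfrak m),\tau(\mathfrak m))$ is not a degree-$2$ central simple algebra with a symplectic involution over $R/\mathfrak m$, then $$\mathrm{gen}_R(B,\tau)\le d+1 .$$ -/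

import Mathlib

open scoped TensorProduct Matrix

universe u v

/-- `τ` is an `R`-involution of the `R`-algebra `B`: an `R`-linear map of order dividing two which
reverses products (it then fixes `1`). -/
structure IsAlgInvolution (R : Type u) {B : Type v} [CommRing R] [Ring B] [Algebra R B]
    (τ : B →ₗ[R] B) : Prop where
  map_mul_rev : ∀ x y : B, τ (x * y) = τ y * τ x
  involutive : ∀ x : B, τ (τ x) = x

/-- `B` as an algebra over its center, via the inclusion; the scalar action is multiplication. -/
instance centerAlgebra (R : Type u) (B : Type v) [CommRing R] [Ring B] [Algebra R B] :
    Algebra (Subalgebra.center R B) B where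
  algebraMap := (Subalgebra.center R B).val.toRingHom
  commutes' := fun z b => ((Subalgebra.mem_center_iff.mp z.2) b).symm
  smul_def' := fun _ _ => rfl

/-- `(B, τ)` is an Azumaya algebra with involution over `R`: `τ` is an `R`-involution, `B` is
Azumaya over its center `Z`, `Z` is finite étale over `R`, and the structure map
`R → {b ∈ Z | τ b = b}` is an isomorphism (i.e. injective with image `{b ∈ Z | τ b = b}`). -/
structure IsAzumayaWithInvolution (R : Type u) {B : Type v} [CommRing R] [Ring B] [Algebra R B]
    (τ : B →ₗ[R] B) : Prop where
  isAlgInvolution : IsAlgInvolution R τ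
  isAzumaya_center : IsAzumaya (Subalgebra.center R B) B
  finite_center : Module.Finite R (Subalgebra.center R B)
  etale_center : Algebra.Etale R (Subalgebra.center R B)
  injective_algebraMap : Function.Injective (algebraMap R B)
  range_algebraMap : Set.range (algebraMap R B) = {b : B | b ∈ Subalgebra.center R B ∧ τ b = b}

/-- `(A, τ)` is a central simple algebra of degree `n` with a symplectic involution over the field
`K`: `A` is a central simple `K`-algebra of dimension `n ^ 2`, `τ` is a `K`-involution (hence of
the first kind), and over some field extension `L` splitting `A`, there is an isomorphism
`φ : L ⊗ A ≃ Mₙ(L)` carrying `τ_L` to the adjoint involution of a nondegenerate alternating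
bilinear form, with Gram matrix `g`, i.e. to `a ↦ g⁻¹ aᵀ g`. -/
structure IsSymplecticCentralSimple (K : Type u) {A : Type v} [Field K] [Ring A] [Algebra K A]
    (n : ℕ) (τ : A →ₗ[K] A) : Prop where
  isCentral : Algebra.IsCentral K A
  isSimpleRing : IsSimpleRing A
  finite : Module.Finite K A
  finrank_eq : Module.finrank K A = n ^ 2
  isAlgInvolution : IsAlgInvolution K τ
  adjoint_alternating : ∃ (L : Type u) (_ : Field L) (_ : Algebra K L)
    (φ : (L ⊗[K] A) ≃ₐ[L] Matrix (Fin n) (Fin n) L) (g : Matrix (Fin n) (Fin n) L),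
    IsUnit g ∧ gᵀ = -g ∧ (∀ i, g i i = 0) ∧
      ∀ x : L ⊗[K] A, φ (τ.baseChange L x) = g⁻¹ * (φ x)ᵀ * g

/-- The fiber `(B(𝔪), τ(𝔪))` of `(B, τ)` at the maximal ideal `𝔪`, with `B(𝔪) = B / 𝔪B` realized as
`(R / 𝔪) ⊗ B`, is a central simple algebra of degree `n` with a symplectic involution over the
residue field `R / 𝔪`. -/
def FiberIsSymplectic {R : Type u} {B : Type v} [CommRing R] [Ring B] [Algebra R B]
    (τ : B →ₗ[R] B) (n : ℕ) (m : MaximalSpectrum R) : Prop :=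
  letI : Field (R ⧸ m.asIdeal) := Ideal.Quotient.field m.asIdeal
  IsSymplecticCentralSimple (R ⧸ m.asIdeal) n (τ.baseChange (R ⧸ m.asIdeal))

/-- The subset `s` generates `(B, τ)` as a unital `R`-algebra with involution: the only (unital)
`R`-subalgebra containing `s` and stable under `τ` is `B`. -/
def GeneratesWithInvolution {R : Type u} {B : Type v} [CommRing R] [Ring B] [Algebra R B]
    (τ : B →ₗ[R] B) (s : Set B) : Prop :=
  ∀ S : Subalgebra R B, s ⊆ S → (∀ x ∈ S, τ x ∈ S) → S = ⊤

/-- `gen_R(B, τ)`: the smallest cardinality of a generating subset of `(B, τ)`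
(`⊤` if there is no finite one). -/
noncomputable def genWithInvolution {R : Type u} {B : Type v} [CommRing R] [Ring B] [Algebra R B]
    (τ : B →ₗ[R] B) : ℕ∞ :=
  ⨅ (s : Set B) (_ : GeneratesWithInvolution τ s), s.encard

/-! The argument is a Forster-type reduction to fibres, followed by explicit generators over fields.

Reduction. Elements are chosen one at a time. The locus in `Max R` where the chosen elements fail to
generate is closed, hence has finitely many irreducible components. By the Chinese remainder theorem
a single new element can restrict to a prescribed fibre generator at one point of each component. By
Nakayama these points leave the locus, so every irreducible closed subset of the new locus lies
strictly inside a component of the old one (`exists_encard_le_and_le_coheight`). After `d + 1`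
choices nothing is left. It remains to generate each fibre by one element.

Fibres. That `x` and `τ x` generate means that some determinant of words in `x`, `τ x` is nonzero, a
polynomial condition on the coordinates of `x`. Over an infinite field it may thus be tested over
the algebraic closure (`exists_adjoin_eq_top_of_baseChange`). Finite and algebraically closed fields
`F` carry no noncommutative central division algebra, so with `N` the shift matrix the nonzero cases
are: (a) `M_n(F) × M_n(F)` with the exchange involution: take `(N, Mᵀ)`, where `M` has last row all
ones; (b) `M_n(C)` with `C = F(θ)` quadratic over a finite field: the involution is adjoint to a
nonalternating hermitian form, and in an orthogonal basis `θ + N` works, its conjugate being a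
scalar plus a lower shift with nonzero weights; (c) `M_n(F)` with the adjoint involution of a
symmetric nonalternating form: diagonalise and take `N`; (d) `M_{2m}(F)` with an alternating form:
in a hyperbolic basis take the block matrix with rows `(0, 1)` and `(N, 0)`. This needs `N ≠ 0`,
i.e. `m ≥ 2`. For `m = 1` the conjugate of `x` is `tr x - x`, so `x` generates only a commutative
algebra: this is the excluded case.

The Azumaya and étale hypotheses enter through `AzumayaInvolutionData`, a list of linear identities
that survive base change and are strong enough over a field to yield these cases. -/

namespace Matrix

/-! ### Shift matrices and pairs generating a matrix algebra. -/

variable {n : ℕ}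

/-- The upper shift matrix, with ones on the superdiagonal. -/
def shift (n : ℕ) (C : Type*) [Zero C] [One C] : Matrix (Fin n) (Fin n) C :=
  of fun i j => if (i : ℕ) + 1 = j then 1 else 0

/-- The lower shift matrix with weights `c`. -/
def weightedLowerShift {C : Type*} [Zero C] (c : Fin n → C) : Matrix (Fin n) (Fin n) C :=
  of fun i j => if (j : ℕ) + 1 = i then c i else 0

section Ring

variable {C : Type*} [CommRing C]

theorem shift_pow_apply (k : ℕ) (i j : Fin n) :
    (shift n C ^ k) i j = if (i : ℕ) + k = j then 1 else 0 := by
  induction k generalizing j with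
  | zero => simp [Matrix.one_apply, Fin.ext_iff]
  | succ k ih =>
    rw [pow_succ, mul_apply]
    simp only [ih, ite_mul, one_mul, zero_mul]
    simp only [shift, of_apply]
    by_cases h : (i : ℕ) + k < n
    · rw [Finset.sum_eq_single ⟨i + k, h⟩]
      · simp [add_assoc]
      · intro b _ hb
        rw [if_neg]
        intro h'
        exact hb (Fin.ext h'.symm)
      · simp
    · rw [Finset.sum_eq_zero, if_neg]
      · omega
      · intro b _
        rw [if_neg]
        omega

theorem shift_pow_self : shift n C ^ n = 0 := by
  ext i j
  rw [shift_pow_apply, if_neg (by omega), zero_apply]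

theorem shift_pow_pred (hn : 0 < n) :
    shift n C ^ (n - 1) = single ⟨0, hn⟩ ⟨n - 1, by omega⟩ 1 := by
  ext i j
  rw [shift_pow_apply, single_apply]
  congr 1
  simp only [Fin.ext_iff, eq_iff_iff]
  omega

theorem single_mul_shift (i j j' : Fin n) (h : (j : ℕ) + 1 = j') :
    single i j (1 : C) * shift n C = single i j' 1 := by
  ext a b
  rw [single_apply]
  by_cases ha : i = a
  · subst ha
    simp only [single_mul_apply_same, shift, of_apply, one_mul, true_and, h, Fin.ext_iff]
  · rw [single_mul_apply_of_ne _ _ _ _ _ (Ne.symm ha)]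
    simp [ha]

theorem shift_mul_single (i i' j : Fin n) (h : (i : ℕ) + 1 = i') :
    shift n C * single i' j (1 : C) = single i j 1 := by
  ext a b
  rw [single_apply]
  by_cases hb : j = b
  · subst hb
    simp only [mul_single_apply_same, shift, of_apply, mul_one, and_true, ← h, Fin.ext_iff]
    congr 1
    simp only [eq_iff_iff]
    omega
  · rw [mul_single_apply_of_ne _ _ _ _ _ (Ne.symm hb)]
    simp [hb]

theorem single_mul_weightedLowerShift (c : Fin n → C) (i j j' : Fin n) (h : (j : ℕ) + 1 = j') :
    single i j' (1 : C) * weightedLowerShift c = c j' • single i j 1 := by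
  ext a b
  rw [smul_apply, single_apply]
  by_cases ha : i = a
  · subst ha
    simp only [single_mul_apply_same, weightedLowerShift, of_apply, one_mul, true_and, ← h,
      Fin.ext_iff, smul_eq_mul, mul_ite, mul_one, mul_zero]
    congr 1
    simp only [eq_iff_iff]
    omega
  · rw [single_mul_apply_of_ne _ _ _ _ _ (Ne.symm ha)]
    simp [ha]

theorem weightedLowerShift_mul_single (c : Fin n → C) (i i' j : Fin n) (h : (i : ℕ) + 1 = i') :
    weightedLowerShift c * single i j (1 : C) = c i' • single i' j 1 := by
  ext a b
  rw [smul_apply, single_apply]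
  by_cases hb : j = b
  · subst hb
    simp only [mul_single_apply_same, weightedLowerShift, of_apply, mul_one, and_true,
      Fin.ext_iff, h, smul_eq_mul, mul_ite, mul_zero]
    by_cases h1 : (i' : ℕ) = a
    · rw [if_pos h1, if_pos h1, Fin.ext h1]
    · rw [if_neg h1, if_neg h1]
  · rw [mul_single_apply_of_ne _ _ _ _ _ (Ne.symm hb)]
    simp [hb]

theorem subalgebra_eq_top_of_single_mem {ι : Type*} [Fintype ι] [DecidableEq ι]
    (S : Subalgebra C (Matrix ι ι C)) (h : ∀ i j, single i j (1 : C) ∈ S) : S = ⊤ := by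
  refine Algebra.eq_top_iff.mpr fun x => ?_
  rw [matrix_eq_sum_single x]
  refine S.sum_mem fun i _ => S.sum_mem fun j _ => ?_
  have := S.smul_mem (h i j) (x i j)
  rwa [smul_single, smul_eq_mul, mul_one] at this

theorem subalgebra_eq_top_of_single_zero_mem (hn : 0 < n)
    (S : Subalgebra C (Matrix (Fin n) (Fin n) C))
    (hr : ∀ j, single ⟨0, hn⟩ j (1 : C) ∈ S) (hc : ∀ i, single i ⟨0, hn⟩ (1 : C) ∈ S) :
    S = ⊤ := by
  refine subalgebra_eq_top_of_single_mem S fun i j => ?_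
  have := S.mul_mem (hc i) (hr j)
  rwa [single_mul_single_same, mul_one] at this

theorem single_zero_mem_of_shift_mem (hn : 0 < n) (S : Subalgebra C (Matrix (Fin n) (Fin n) C))
    (hN : shift n C ∈ S) (h0 : single ⟨0, hn⟩ ⟨0, hn⟩ (1 : C) ∈ S) (j : Fin n) :
    single ⟨0, hn⟩ j (1 : C) ∈ S := by
  obtain ⟨j, hj⟩ := j
  induction j with
  | zero => exact h0
  | succ j ih =>
    have := S.mul_mem (ih (by omega)) hN
    rwa [single_mul_shift _ _ ⟨j + 1, hj⟩ rfl] at this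

/-- The last row consists of ones, the others vanish. -/
def lastRowOnes (n : ℕ) (C : Type*) [Zero C] [One C] : Matrix (Fin n) (Fin n) C :=
  of fun i _ => if (i : ℕ) + 1 = n then 1 else 0

theorem single_last_mul_lastRowOnes (hn : 0 < n) (i j : Fin n) :
    single i ⟨n - 1, by omega⟩ (1 : C) * lastRowOnes n C * single j j 1 = single i j 1 := by
  ext a b
  by_cases hb : j = b
  · subst hb
    rw [mul_single_apply_same, mul_one]
    by_cases ha : i = a
    · subst ha
      simp only [single_mul_apply_same, lastRowOnes, of_apply, one_mul, single_apply_same]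
      rw [if_pos (by omega)]
    · rw [single_mul_apply_of_ne _ _ _ _ _ (Ne.symm ha)]
      simp [ha]
  · rw [mul_single_apply_of_ne _ _ _ _ _ (Ne.symm hb)]
    simp [hb]

theorem lastRowOnes_mul_self : lastRowOnes n C * lastRowOnes n C = lastRowOnes n C := by
  ext i j
  have hi := i.2
  simp only [mul_apply, lastRowOnes, of_apply]
  rw [Finset.sum_eq_single ⟨n - 1, by omega⟩]
  · rw [if_pos (show n - 1 + 1 = n by omega), mul_one]
  · intro b _ hb
    rw [if_neg (show ¬ (b : ℕ) + 1 = n from fun h => hb (Fin.ext (by simp; omega))), mul_zero]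
  · simp

theorem single_mul_lastRowOnes_mul_one_sub_shift (hn : 0 < n) (i : Fin n) :
    single i ⟨n - 1, by omega⟩ (1 : C) * lastRowOnes n C * (1 - shift n C)
      = single i ⟨0, hn⟩ 1 := by
  ext a b
  rw [Matrix.mul_assoc]
  by_cases ha : i = a
  · subst ha
    rw [single_mul_apply_same, one_mul, mul_sub, mul_one, sub_apply, mul_apply]
    simp only [lastRowOnes, of_apply, shift]
    simp only [show n - 1 + 1 = n by omega, if_true, one_mul]
    rw [single_apply]
    by_cases hb : (b : ℕ) = 0
    · rw [Finset.sum_eq_zero]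
      · simp [Fin.ext_iff, hb]
      · intro x _
        rw [if_neg (by omega)]
    · rw [Finset.sum_eq_single ⟨b - 1, by omega⟩]
      · rw [if_pos (by simp; omega), if_neg, sub_self]
        simp [Fin.ext_iff]
        omega
      · intro x _ hx
        rw [if_neg fun h => hx (Fin.ext (by simp; omega))]
      · simp
  · rw [single_mul_apply_of_ne _ _ _ _ _ (Ne.symm ha)]
    simp [ha]

theorem lastRowOnes_mul_single (hn : 0 < n) (j : Fin n) :
    lastRowOnes n C * single j j (1 : C) = single ⟨n - 1, by omega⟩ j 1 := by
  ext a b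
  by_cases hb : j = b
  · subst hb
    rw [mul_single_apply_same, mul_one, single_apply]
    simp only [lastRowOnes, of_apply, and_true, Fin.ext_iff]
    congr 1
    simp only [eq_iff_iff]
    omega
  · rw [mul_single_apply_of_ne _ _ _ _ _ (Ne.symm hb)]
    simp [hb]

/-- The power `N ^ (n - 1)` is the upper right matrix unit. Multiplying it by the matrix of ones and
then by `1 - N` telescopes the row of ones to the unit at `(0, 0)`. From there `N` on the right
fills the first row, the matrix of ones jumps to the bottom of the first column, and `N` on the left
climbs that column. -/
theorem subalgebra_eq_top_of_shift_of_lastRowOnes_mem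
    (S : Subalgebra C (Matrix (Fin n) (Fin n) C))
    (hN : shift n C ∈ S) (hM : lastRowOnes n C ∈ S) : S = ⊤ := by
  rcases Nat.eq_zero_or_pos n with rfl | hn
  · exact Algebra.eq_top_iff.mpr fun x => by
      rw [Subsingleton.elim x 0]; exact S.zero_mem
  have h0 : single ⟨0, hn⟩ ⟨0, hn⟩ (1 : C) ∈ S := by
    rw [← single_mul_lastRowOnes_mul_one_sub_shift hn, ← shift_pow_pred hn]
    exact S.mul_mem (S.mul_mem (S.pow_mem hN _) hM) (S.sub_mem S.one_mem hN)
  refine subalgebra_eq_top_of_single_zero_mem hn S (single_zero_mem_of_shift_mem hn S hN h0) ?_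
  have hlast : single ⟨n - 1, by omega⟩ ⟨0, hn⟩ (1 : C) ∈ S := by
    rw [← lastRowOnes_mul_single hn]
    exact S.mul_mem hM h0
  have key : ∀ k, ∀ hk : k < n, single ⟨n - 1 - k, by omega⟩ ⟨0, hn⟩ (1 : C) ∈ S := by
    intro k
    induction k with
    | zero => exact fun _ => hlast
    | succ k ih =>
      intro hk
      rw [← shift_mul_single _ ⟨n - 1 - k, by omega⟩ _ (by simp; omega)]
      exact S.mul_mem hN (ih (by omega))
  intro i
  convert key (n - 1 - i) (by omega) using 2
  exact Fin.ext (by simp; omega)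

end Ring

section Field

variable {C : Type*} [Field C]

/-- Starting from the corner unit `N ^ (n - 1)`, the lower shift acts on the right to move left
along the first row and then on the left to move down the first column. The weights that appear are
divided out. -/
theorem subalgebra_eq_top_of_shift_of_weightedLowerShift_mem
    (S : Subalgebra C (Matrix (Fin n) (Fin n) C)) (c : Fin n → C) (hc : ∀ i, c i ≠ 0)
    (hN : shift n C ∈ S) (hN' : weightedLowerShift c ∈ S) : S = ⊤ := by
  rcases Nat.eq_zero_or_pos n with rfl | hn
  · exact Algebra.eq_top_iff.mpr fun x => by
      rw [Subsingleton.elim x 0]; exact S.zero_mem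
  have smem : ∀ {a : C} {x : Matrix (Fin n) (Fin n) C}, a ≠ 0 → a • x ∈ S → x ∈ S := by
    intro a x ha hx
    have := S.smul_mem hx a⁻¹
    rwa [smul_smul, inv_mul_cancel₀ ha, one_smul] at this
  have key : ∀ k, ∀ hk : k < n, single ⟨0, hn⟩ ⟨n - 1 - k, by omega⟩ (1 : C) ∈ S := by
    intro k
    induction k with
    | zero =>
      intro _
      have := S.pow_mem hN (n - 1)
      rwa [shift_pow_pred hn] at this
    | succ k ih =>
      intro hk
      have := S.mul_mem (ih (by omega)) hN'
      rw [single_mul_weightedLowerShift c _ ⟨n - 1 - (k + 1), by omega⟩ _ (by simp; omega)] at this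
      exact smem (hc _) this
  have hrow : ∀ j, single ⟨0, hn⟩ j (1 : C) ∈ S := by
    intro i
    convert key (n - 1 - i) (by omega) using 2
    exact Fin.ext (by simp; omega)
  refine subalgebra_eq_top_of_single_zero_mem hn S hrow ?_
  rintro ⟨i, hi⟩
  induction i with
  | zero => exact hrow _
  | succ i ih =>
    have := S.mul_mem hN' (ih (by omega))
    rw [weightedLowerShift_mul_single c _ ⟨i + 1, hi⟩ _ rfl] at this
    exact smem (hc _) this

end Field

end Matrix

/-! ### Explicit single generators for the model involutions. -/

namespace Matrix

variable {n : ℕ}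

/-- With `q` the order of `C`, the `q ^ n`-th power is additive on commuting elements, fixes `θ`,
and kills the nilpotent `N` because `q ^ n ≥ n`. -/
theorem algebraMap_mem_of_add_shift_mem {C : Type*} [Field C] [Finite C] {F : Type*} [Field F]
    [Algebra F C] (S : Subalgebra F (Matrix (Fin n) (Fin n) C)) (θ : C)
    (h : algebraMap C _ θ + shift n C ∈ S) : algebraMap C (Matrix (Fin n) (Fin n) C) θ ∈ S := by
  rcases Nat.eq_zero_or_pos n with rfl | hn
  · rw [Subsingleton.elim (algebraMap C (Matrix (Fin 0) (Fin 0) C) θ) 0]; exact S.zero_mem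
  have : Nonempty (Fin n) := ⟨⟨0, hn⟩⟩
  have := Fintype.ofFinite C
  obtain ⟨p, hp⟩ := CharP.exists C
  obtain ⟨k, hpp, hk⟩ := FiniteField.card C p
  have : Fact p.Prime := ⟨hpp⟩
  have : CharP (Matrix (Fin n) (Fin n) C) p := inferInstance
  have hcomm : Commute (algebraMap C (Matrix (Fin n) (Fin n) C) θ) (shift n C) :=
    Algebra.commutes θ _
  have key : (algebraMap C (Matrix (Fin n) (Fin n) C) θ + shift n C) ^ (p ^ (k * n : ℕ)) =
      algebraMap C _ θ := by
    rw [add_pow_char_pow_of_commute p (k * n) hcomm]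
    have h2 : p ^ (k * n : ℕ) = Fintype.card C ^ n := by rw [hk, pow_mul]
    have h3 : n ≤ p ^ (k * n : ℕ) := by
      rw [h2]
      exact (Nat.lt_pow_self Fintype.one_lt_card).le
    rw [pow_eq_zero_of_le h3 (shift_pow_self (C := C)), add_zero, h2, ← map_pow,
      FiniteField.pow_card_pow]
  rw [← key]
  exact S.pow_mem h _

/-- Once the scalar `θ` is separated from `N`, the algebra contains all of `C` and the problem
becomes `C`-linear. The alternative `θ = 0` serves involutions of the first kind (then `C` is the
image of `F`); finiteness of `C` serves the second kind. -/
theorem adjoin_shift_weightedLowerShift {C : Type*} [Field C] {F : Type*} [Field F]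
    [Algebra F C] (θ θ' : C) (c : Fin n → C) (hc : ∀ i, c i ≠ 0)
    (hθ : Algebra.adjoin F {θ} = ⊤) (h : θ = 0 ∨ Finite C) :
    Algebra.adjoin F {algebraMap C _ θ + shift n C, algebraMap C _ θ' + weightedLowerShift c} =
      (⊤ : Subalgebra F (Matrix (Fin n) (Fin n) C)) := by
  set S := Algebra.adjoin F {algebraMap C _ θ + shift n C, algebraMap C _ θ' + weightedLowerShift c}
    with hS
  have hx : algebraMap C _ θ + shift n C ∈ S := Algebra.subset_adjoin (by simp)
  have hy : algebraMap C _ θ' + weightedLowerShift c ∈ S := Algebra.subset_adjoin (by simp)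
  have hmem : algebraMap C (Matrix (Fin n) (Fin n) C) θ ∈ S := by
    rcases h with rfl | h
    · rw [map_zero]; exact S.zero_mem
    · exact algebraMap_mem_of_add_shift_mem S θ hx
  have hC : ∀ a : C, algebraMap C (Matrix (Fin n) (Fin n) C) a ∈ S := by
    have hle : Algebra.adjoin F {θ} ≤ S.comap (IsScalarTower.toAlgHom F C _) :=
      Algebra.adjoin_le (by simpa using hmem)
    intro a
    have := hle (hθ ▸ Algebra.mem_top : a ∈ Algebra.adjoin F {θ})
    simpa using this
  let T : Subalgebra C (Matrix (Fin n) (Fin n) C) := { S with algebraMap_mem' := hC }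
  have hT : T = ⊤ := by
    refine subalgebra_eq_top_of_shift_of_weightedLowerShift_mem T c hc ?_ ?_
    · have := S.sub_mem hx (hC θ)
      rwa [add_sub_cancel_left] at this
    · have := S.sub_mem hy (hC θ')
      rwa [add_sub_cancel_left] at this
  exact Algebra.eq_top_iff.mpr fun a => (hT ▸ Algebra.mem_top : a ∈ T)

theorem subalgebra_transpose_eq_top {C : Type*} [CommRing C]
    (S : Subalgebra C (Matrix (Fin n) (Fin n) C)) (hN : (shift n C)ᵀ ∈ S)
    (hM : (lastRowOnes n C)ᵀ ∈ S) : S = ⊤ := by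
  let T : Subalgebra C (Matrix (Fin n) (Fin n) C) :=
    { carrier := {x | xᵀ ∈ S}
      mul_mem' := fun {a b} ha hb => by
        rw [Set.mem_ofPred_eq, transpose_mul]; exact S.mul_mem hb ha
      add_mem' := fun {a b} ha hb => by
        rw [Set.mem_ofPred_eq, transpose_add]; exact S.add_mem ha hb
      algebraMap_mem' := fun r => by
        rw [Set.mem_ofPred_eq, algebraMap_eq_diagonal, diagonal_transpose,
          ← algebraMap_eq_diagonal]
        exact S.algebraMap_mem r }
  have hT : T = ⊤ := subalgebra_eq_top_of_shift_of_lastRowOnes_mem T hN hM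
  refine Algebra.eq_top_iff.mpr fun x => ?_
  have : xᵀ ∈ T := hT ▸ Algebra.mem_top
  exact this

/-- A single element generates two copies of a matrix algebra under the transpose-exchange
involution. -/
theorem adjoin_exchange_eq_top {C : Type*} [Field C] :
    Algebra.adjoin C {(shift n C, (lastRowOnes n C)ᵀ), (lastRowOnes n C, (shift n C)ᵀ)} =
      (⊤ : Subalgebra C (Matrix (Fin n) (Fin n) C × Matrix (Fin n) (Fin n) C)) := by
  rcases Nat.eq_zero_or_pos n with rfl | hn
  · exact Algebra.eq_top_iff.mpr fun x => by
      rw [Subsingleton.elim x 0]; exact Subalgebra.zero_mem _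
  set S := Algebra.adjoin C
    {(shift n C, (lastRowOnes n C)ᵀ), (lastRowOnes n C, (shift n C)ᵀ)} with hS
  have hx : (shift n C, (lastRowOnes n C)ᵀ) ∈ S := Algebra.subset_adjoin (by simp)
  have hy : (lastRowOnes n C, (shift n C)ᵀ) ∈ S := Algebra.subset_adjoin (by simp)
  have h1 : S.map (AlgHom.fst C _ _) = ⊤ :=
    subalgebra_eq_top_of_shift_of_lastRowOnes_mem _ ⟨_, hx, rfl⟩ ⟨_, hy, rfl⟩
  have h2 : S.map (AlgHom.snd C _ _) = ⊤ :=
    subalgebra_transpose_eq_top _ ⟨_, hy, rfl⟩ ⟨_, hx, rfl⟩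
  -- The first component is idempotent and the second nilpotent, so the `n`-th power separates the
  -- two factors.
  have hM : (lastRowOnes n C, (0 : Matrix (Fin n) (Fin n) C)) ∈ S := by
    have hpow : ∀ k, lastRowOnes n C ^ (k + 1) = lastRowOnes n C := by
      intro k
      induction k with
      | zero => rw [zero_add, pow_one]
      | succ k ih => rw [pow_succ, ih, lastRowOnes_mul_self]
    have := S.pow_mem hy n
    rw [Prod.pow_mk, ← transpose_pow, shift_pow_self, transpose_zero] at this
    have hn1 := hpow (n - 1)
    rw [Nat.sub_add_cancel hn] at hn1
    rwa [hn1] at this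
  -- The elements of `S` with zero second component form an ideal of `S`, and `S` projects onto the
  -- first factor. Multiplying `(M, 0)` by lifts of matrix units gives every `(E_ij, 0)`.
  have hfst : ∀ a : Matrix (Fin n) (Fin n) C, (a, (0 : Matrix (Fin n) (Fin n) C)) ∈ S := by
    have hlift : ∀ a : Matrix (Fin n) (Fin n) C, ∃ b, (a, b) ∈ S := fun a => by
      obtain ⟨⟨a', b⟩, hb, rfl⟩ := (h1 ▸ Algebra.mem_top : a ∈ S.map (AlgHom.fst C _ _))
      exact ⟨b, hb⟩
    intro a
    rw [matrix_eq_sum_single a]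
    have hs : ∀ i j, (single i j (a i j), (0 : Matrix (Fin n) (Fin n) C)) ∈ S := by
      intro i j
      obtain ⟨b, hb⟩ := hlift (single i ⟨n - 1, by omega⟩ (1 : C))
      obtain ⟨b', hb'⟩ := hlift (single j j (1 : C))
      have := S.smul_mem (S.mul_mem (S.mul_mem hb hM) hb') (a i j)
      rw [Prod.mk_mul_mk, Prod.mk_mul_mk, single_last_mul_lastRowOnes hn, mul_zero, zero_mul,
        Prod.smul_mk, smul_zero, smul_single, smul_eq_mul, mul_one] at this
      exact this
    let T := S.toSubmodule.comap (LinearMap.inl C (Matrix (Fin n) (Fin n) C) _)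
    change ∑ i, ∑ j, single i j (a i j) ∈ T
    exact T.sum_mem fun i _ => T.sum_mem fun j _ => hs i j
  refine Algebra.eq_top_iff.mpr fun ⟨a, b⟩ => ?_
  obtain ⟨⟨a', b'⟩, hb, rfl⟩ := (h2 ▸ Algebra.mem_top : b ∈ S.map (AlgHom.snd C _ _))
  have := S.add_mem hb (hfst (a - a'))
  rw [Prod.mk_add_mk, add_sub_cancel, add_zero] at this
  exact this

/-- The set of blocks `a` with `e a f` in a subalgebra absorbs shifts on both sides, hence is
everything as soon as it contains a nonzero matrix. -/
theorem eq_univ_of_absorbs_shift {C : Type*} [Field C] (T : Submodule C (Matrix (Fin n) (Fin n) C))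
    (hl : ∀ a ∈ T, shift n C * a ∈ T) (hl' : ∀ a ∈ T, (shift n C)ᵀ * a ∈ T)
    (hr : ∀ a ∈ T, a * shift n C ∈ T) (hr' : ∀ a ∈ T, a * (shift n C)ᵀ ∈ T)
    (k : Matrix (Fin n) (Fin n) C) (hk : k ∈ T) (hk0 : k ≠ 0) : T = ⊤ := by
  have hT' : (shift n C)ᵀ = weightedLowerShift fun _ => (1 : C) := by
    ext i j
    simp [shift, weightedLowerShift]
  -- The left multipliers of `T`, and below the right ones, form subalgebras containing `N` and
  -- `Nᵀ`, hence are everything: `T` is a two-sided ideal.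
  let Sl : Subalgebra C (Matrix (Fin n) (Fin n) C) :=
    { carrier := {x | ∀ a ∈ T, x * a ∈ T}
      mul_mem' := fun {x y} hx hy a ha => by rw [Matrix.mul_assoc]; exact hx _ (hy _ ha)
      add_mem' := fun {x y} hx hy a ha => by
        rw [Matrix.add_mul]; exact T.add_mem (hx _ ha) (hy _ ha)
      algebraMap_mem' := fun r a ha => by
        rw [← Algebra.smul_def]; exact T.smul_mem r ha }
  let Sr : Subalgebra C (Matrix (Fin n) (Fin n) C) :=
    { carrier := {x | ∀ a ∈ T, a * x ∈ T}
      mul_mem' := fun {x y} hx hy a ha => by rw [← Matrix.mul_assoc]; exact hy _ (hx _ ha)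
      add_mem' := fun {x y} hx hy a ha => by
        rw [Matrix.mul_add]; exact T.add_mem (hx _ ha) (hy _ ha)
      algebraMap_mem' := fun r a ha => by
        rw [← Algebra.commutes, ← Algebra.smul_def]; exact T.smul_mem r ha }
  have hSl : Sl = ⊤ := subalgebra_eq_top_of_shift_of_weightedLowerShift_mem Sl (fun _ => 1)
    (fun _ => one_ne_zero) hl (hT' ▸ hl')
  have hSr : Sr = ⊤ := subalgebra_eq_top_of_shift_of_weightedLowerShift_mem Sr (fun _ => 1)
    (fun _ => one_ne_zero) hr (hT' ▸ hr')
  have hL : ∀ x, ∀ a ∈ T, x * a ∈ T := fun x => (hSl ▸ Algebra.mem_top : x ∈ Sl)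
  have hR : ∀ x, ∀ a ∈ T, a * x ∈ T := fun x => (hSr ▸ Algebra.mem_top : x ∈ Sr)
  obtain ⟨p, q, hpq⟩ : ∃ p q, k p q ≠ 0 := by
    by_contra! h
    exact hk0 (Matrix.ext h)
  refine Submodule.eq_top_iff'.mpr fun x => ?_
  rw [matrix_eq_sum_single x]
  refine T.sum_mem fun i _ => T.sum_mem fun j _ => ?_
  have := T.smul_mem (x i j * (k p q)⁻¹) (hR (single q j 1) _ (hL (single i p 1) _ hk))
  convert this using 1
  rw [single_mul_mul_single, smul_single]
  simp [hpq]

/-- A single element generates a matrix algebra of degree `2 m ≥ 4` under the standard symplectic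
involution. -/
theorem adjoin_symplectic_eq_top {C : Type*} [Field C] {m : ℕ} (hm : 2 ≤ m) :
    Algebra.adjoin C {fromBlocks 0 (1 : Matrix (Fin m) (Fin m) C) (shift m C) 0,
      fromBlocks 0 (-1 : Matrix (Fin m) (Fin m) C) (-(shift m C)ᵀ) 0} =
      (⊤ : Subalgebra C (Matrix (Fin m ⊕ Fin m) (Fin m ⊕ Fin m) C)) := by
  set S := Algebra.adjoin C {fromBlocks 0 (1 : Matrix (Fin m) (Fin m) C) (shift m C) 0,
      fromBlocks 0 (-1 : Matrix (Fin m) (Fin m) C) (-(shift m C)ᵀ) 0}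
    with hS
  set N := shift m C with hN
  have hx : fromBlocks 0 (1 : Matrix (Fin m) (Fin m) C) N 0 ∈ S :=
    Algebra.subset_adjoin (by simp [hN])
  have hy : fromBlocks 0 (-1 : Matrix (Fin m) (Fin m) C) (-Nᵀ) 0 ∈ S :=
    Algebra.subset_adjoin (by simp [hN])
  -- The products of the two generators give the block diagonal matrices with blocks `N` or `Nᵀ` in
  -- all four combinations. Their differences isolate one diagonal block.
  have hNN : fromBlocks N 0 0 N ∈ S := by
    simpa [fromBlocks_multiply] using S.mul_mem hx hx
  have hTT : fromBlocks Nᵀ 0 0 Nᵀ ∈ S := by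
    simpa [fromBlocks_multiply] using S.mul_mem hy hy
  have hTN : fromBlocks Nᵀ 0 0 N ∈ S := by
    simpa [fromBlocks_multiply, fromBlocks_neg] using S.neg_mem (S.mul_mem hx hy)
  have hNT : fromBlocks N 0 0 Nᵀ ∈ S := by
    simpa [fromBlocks_multiply, fromBlocks_neg] using S.neg_mem (S.mul_mem hy hx)
  have h01 : N ⟨0, by omega⟩ ⟨1, by omega⟩ = 1 := by simp [hN, shift]
  have h10 : N ⟨1, by omega⟩ ⟨0, by omega⟩ = 0 := by simp [hN, shift]
  have hN0 : N ≠ 0 := fun h => by simp [h] at h01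
  -- This is where `2 ≤ m` is indispensable: for `m = 1` the shift is zero.
  have hk : N - Nᵀ ≠ 0 := fun h => by
    have := congr_fun (congr_fun h ⟨0, by omega⟩) ⟨1, by omega⟩
    rw [sub_apply, transpose_apply, h01, h10] at this
    simp at this
  have key : ∀ (f : Matrix (Fin m) (Fin m) C →ₗ[C] Matrix (Fin m ⊕ Fin m) (Fin m ⊕ Fin m) C)
      (_ : ∀ x a, fromBlocks x 0 0 x * f a = f (x * a))
      (_ : ∀ x a, f a * fromBlocks x 0 0 x = f (a * x))
      (k : Matrix (Fin m) (Fin m) C) (_ : f k ∈ S) (_ : k ≠ 0), ∀ a, f a ∈ S := by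
    intro f hl hr k hk hk0 a
    have := eq_univ_of_absorbs_shift (S.toSubmodule.comap f)
      (fun a ha => by simpa [hl] using S.mul_mem hNN ha)
      (fun a ha => by simpa [hl] using S.mul_mem hTT ha)
      (fun a ha => by simpa [hr] using S.mul_mem ha hNN)
      (fun a ha => by simpa [hr] using S.mul_mem ha hTT) k hk hk0
    exact (this ▸ Submodule.mem_top : a ∈ S.toSubmodule.comap f)
  have h11 : ∀ a, fromBlocks a 0 0 0 ∈ S := by
    refine key ⟨⟨fun a => fromBlocks a 0 0 0, fun a b => by simp [fromBlocks_add]⟩,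
      fun c a => by simp [fromBlocks_smul]⟩ ?_ ?_ (N - Nᵀ) ?_ hk
    · intro x a; simp [fromBlocks_multiply]
    · intro x a; simp [fromBlocks_multiply]
    · have := S.sub_mem hNN hTN
      simpa [sub_eq_add_neg, fromBlocks_neg, fromBlocks_add] using this
  have h22 : ∀ a, fromBlocks 0 0 0 a ∈ S := by
    refine key ⟨⟨fun a => fromBlocks 0 0 0 a, fun a b => by simp [fromBlocks_add]⟩,
      fun c a => by simp [fromBlocks_smul]⟩ ?_ ?_ (N - Nᵀ) ?_ hk
    · intro x a; simp [fromBlocks_multiply]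
    · intro x a; simp [fromBlocks_multiply]
    · have := S.sub_mem hNN hNT
      simpa [sub_eq_add_neg, fromBlocks_neg, fromBlocks_add] using this
  have h12 : ∀ a, fromBlocks 0 a 0 0 ∈ S := by
    intro a
    simpa [fromBlocks_multiply] using S.mul_mem hx (h22 a)
  have h21 : ∀ a, fromBlocks 0 0 a 0 ∈ S := by
    refine key ⟨⟨fun a => fromBlocks 0 0 a 0, fun a b => by simp [fromBlocks_add]⟩,
      fun c a => by simp [fromBlocks_smul]⟩ ?_ ?_ N ?_ hN0
    · intro x a; simp [fromBlocks_multiply]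
    · intro x a; simp [fromBlocks_multiply]
    · simpa [fromBlocks_multiply] using S.mul_mem hx (h11 1)
  refine Algebra.eq_top_iff.mpr fun x => ?_
  rw [← fromBlocks_toBlocks x]
  have := S.add_mem (S.add_mem (h11 x.toBlocks₁₁) (h12 x.toBlocks₁₂))
    (S.add_mem (h21 x.toBlocks₂₁) (h22 x.toBlocks₂₂))
  simpa [fromBlocks_add] using this

end Matrix

/-! ### Hermitian and alternating forms: orthogonal and hyperbolic bases. -/

namespace Matrix

variable {C : Type*} [Field C] [StarRing C] {n : ℕ}

/-- The sesquilinear form with Gram matrix `g`. -/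
def sesqForm (g : Matrix (Fin n) (Fin n) C) (v w : Fin n → C) : C := star v ⬝ᵥ g *ᵥ w

variable (g : Matrix (Fin n) (Fin n) C)

theorem sesqForm_add_left (u v w : Fin n → C) :
    sesqForm g (u + v) w = sesqForm g u w + sesqForm g v w := by
  simp [sesqForm, add_dotProduct]

theorem sesqForm_add_right (u v w : Fin n → C) :
    sesqForm g u (v + w) = sesqForm g u v + sesqForm g u w := by
  simp [sesqForm, mulVec_add]

theorem sesqForm_sub_right (u v w : Fin n → C) :
    sesqForm g u (v - w) = sesqForm g u v - sesqForm g u w := by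
  simp [sesqForm, mulVec_sub]

theorem sesqForm_sub_left (u v w : Fin n → C) :
    sesqForm g (u - v) w = sesqForm g u w - sesqForm g v w := by
  simp [sesqForm, sub_dotProduct]

theorem sesqForm_smul_right (a : C) (v w : Fin n → C) :
    sesqForm g v (a • w) = a * sesqForm g v w := by
  simp [sesqForm, mulVec_smul]

theorem sesqForm_smul_left (a : C) (v w : Fin n → C) :
    sesqForm g (a • v) w = star a * sesqForm g v w := by
  simp [sesqForm]

theorem sesqForm_sum_right {ι : Type*} (s : Finset ι) (v : Fin n → C) (w : ι → Fin n → C) :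
    sesqForm g v (∑ i ∈ s, w i) = ∑ i ∈ s, sesqForm g v (w i) := by
  simp [sesqForm, mulVec_sum, dotProduct_sum]

theorem star_sesqForm (v w : Fin n → C) : star (sesqForm g v w) = sesqForm gᴴ w v := by
  rw [sesqForm, sesqForm, ← star_dotProduct, star_mulVec, ← dotProduct_mulVec]

theorem conjTranspose_mul_mul_apply {ι : Type*} [Fintype ι] (P : Matrix (Fin n) ι C) (i j : ι) :
    (Pᴴ * g * P) i j = sesqForm g (fun k => P k i) (fun k => P k j) := by
  rw [Matrix.mul_assoc]
  simp [sesqForm, mul_apply, dotProduct, mulVec]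

theorem exists_sesqForm_ne_zero (hg : IsUnit g) {w : Fin n → C} (hw : w ≠ 0) :
    ∃ v, sesqForm g v w ≠ 0 := by
  by_contra! h
  apply hw
  have h0 : g *ᵥ w = 0 := by
    refine dotProduct_eq_zero _ fun v => ?_
    have := h (star v)
    rwa [sesqForm, star_star, dotProduct_comm] at this
  have hinj := (mulVec_injective_iff_isUnit.mpr hg)
  exact hinj (h0.trans (mulVec_zero g).symm)

/-- Fewer than `n` vectors have a nonzero common orthogonal vector. -/
theorem exists_ne_zero_forall_sesqForm_eq_zero {ι : Type*} [Fintype ι]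
    (hk : Fintype.card ι < n) (v : ι → Fin n → C) :
    ∃ w ≠ 0, ∀ i, sesqForm g (v i) w = 0 := by
  let L : (Fin n → C) →ₗ[C] (ι → C) := LinearMap.pi fun i =>
    { toFun := fun w => sesqForm g (v i) w
      map_add' := fun a b => sesqForm_add_right g _ _ _
      map_smul' := fun a b => sesqForm_smul_right g _ _ _ }
  have hL : LinearMap.ker L ≠ ⊥ := LinearMap.ker_ne_bot_of_finrank_lt (by simpa using hk)
  obtain ⟨w, hw, hw0⟩ := Submodule.exists_mem_ne_zero_of_ne_bot hL
  exact ⟨w, hw0, fun i => congr_fun (LinearMap.mem_ker.mp hw) i⟩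

variable {g}

theorem sesqForm_eq_zero_comm (hg : gᴴ = g) {v w : Fin n → C} (h : sesqForm g v w = 0) :
    sesqForm g w v = 0 := by
  have := star_sesqForm g v w
  rwa [h, star_zero, hg, eq_comm] at this

/-- Orthogonalization: a nonalternating hermitian form has an orthogonal family of anisotropic
vectors of each length whose complement is nonalternating unless it vanishes. -/
theorem exists_orthogonal_family (hg : IsUnit g) (hh : gᴴ = g) (hna : ∃ v, sesqForm g v v ≠ 0)
    (k : ℕ) (hk : k ≤ n) :
    ∃ v : Fin k → Fin n → C, (∀ i j, i ≠ j → sesqForm g (v i) (v j) = 0) ∧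
      (∀ i, sesqForm g (v i) (v i) ≠ 0) ∧
      (k < n → ∃ w, (∀ i, sesqForm g (v i) w = 0) ∧ sesqForm g w w ≠ 0) := by
  induction k with
  | zero =>
    exact ⟨fun i => i.elim0, fun i => i.elim0, fun i => i.elim0,
      fun _ => hna.imp fun w hw => ⟨fun i => i.elim0, hw⟩⟩
  | succ k ih =>
    obtain ⟨v, ho, ha, hw⟩ := ih (by omega)
    obtain ⟨w₀, hw₀, hw₀a⟩ := hw (by omega)
    -- extending by an anisotropic vector of the complement
    have ext : ∀ u, (∀ i, sesqForm g (v i) u = 0) → sesqForm g u u ≠ 0 →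
        (k + 1 < n → ∃ w, (∀ i, sesqForm g (v i) w = 0) ∧ sesqForm g u w = 0 ∧
          sesqForm g w w ≠ 0) →
        ∃ v : Fin (k + 1) → Fin n → C, (∀ i j, i ≠ j → sesqForm g (v i) (v j) = 0) ∧
          (∀ i, sesqForm g (v i) (v i) ≠ 0) ∧
          (k + 1 < n → ∃ w, (∀ i, sesqForm g (v i) w = 0) ∧ sesqForm g w w ≠ 0) := by
      intro u hu hua hw
      refine ⟨Fin.snoc v u, ?_, ?_, fun hkn => ?_⟩
      · intro i j hij
        induction i using Fin.lastCases with
        | last =>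
          induction j using Fin.lastCases with
          | last => exact absurd rfl hij
          | cast j => simpa using sesqForm_eq_zero_comm hh (hu j)
        | cast i =>
          induction j using Fin.lastCases with
          | last => simpa using hu i
          | cast j => simpa using ho i j (fun h => hij (by rw [h]))
      · intro i
        induction i using Fin.lastCases with
        | last => simpa using hua
        | cast i => simpa using ha i
      · obtain ⟨w, h1, h2, h3⟩ := hw hkn
        refine ⟨w, fun i => ?_, h3⟩
        induction i using Fin.lastCases with
        | last => simpa using h2
        | cast i => simpa using h1 i
    -- Taking `w₀` as the next vector is harmless unless the form becomes alternating on the nonzero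
    -- complement that remains.
    by_cases hU : k + 1 < n → ∃ w, (∀ i, sesqForm g (v i) w = 0) ∧ sesqForm g w₀ w = 0 ∧
          sesqForm g w w ≠ 0
    · exact ext w₀ hw₀ hw₀a hU
    · push Not at hU
      obtain ⟨hkn, hU⟩ := hU
      obtain ⟨w, hwne, hwo⟩ := exists_ne_zero_forall_sesqForm_eq_zero g
        ((Fintype.card_fin _).trans_lt hkn) (Fin.snoc v w₀ : Fin (k + 1) → Fin n → C)
      have hwv : ∀ i, sesqForm g (v i) w = 0 := fun i => by simpa using hwo i.castSucc
      have hww₀ : sesqForm g w₀ w = 0 := by simpa using hwo (Fin.last k)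
      have hww : sesqForm g w w = 0 := hU w hwv hww₀
      obtain ⟨w₁, hw₁⟩ : ∃ w₁, sesqForm g w w₁ ≠ 0 := by
        obtain ⟨w₁, hw₁⟩ := exists_sesqForm_ne_zero g hg hwne
        exact ⟨w₁, fun h => hw₁ (sesqForm_eq_zero_comm hh h)⟩
      -- project to the complement
      obtain ⟨w₂, hw₂v, hw₂w₀, hw₂⟩ : ∃ w₂, (∀ i, sesqForm g (v i) w₂ = 0) ∧
          sesqForm g w₀ w₂ = 0 ∧ sesqForm g w w₂ = 1 := by
        set t := w₁ - ∑ i, (sesqForm g (v i) w₁ / sesqForm g (v i) (v i)) • v i -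
          (sesqForm g w₀ w₁ / sesqForm g w₀ w₀) • w₀ with ht
        have htv : ∀ i, sesqForm g (v i) t = 0 := by
          intro i
          rw [ht, sesqForm_sub_right, sesqForm_sub_right, sesqForm_sum_right, sesqForm_smul_right,
            hw₀ i, Finset.sum_eq_single i]
          · rw [sesqForm_smul_right, div_mul_cancel₀ _ (ha i)]; ring
          · intro j _ hj
            rw [sesqForm_smul_right, ho i j (Ne.symm hj), mul_zero]
          · simp
        have htw₀ : sesqForm g w₀ t = 0 := by
          rw [ht, sesqForm_sub_right, sesqForm_sub_right, sesqForm_sum_right, sesqForm_smul_right,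
            Finset.sum_eq_zero, div_mul_cancel₀ _ hw₀a]
          · ring
          · intro j _
            rw [sesqForm_smul_right, sesqForm_eq_zero_comm hh (hw₀ j), mul_zero]
        have htw : sesqForm g w t = sesqForm g w w₁ := by
          rw [ht, sesqForm_sub_right, sesqForm_sub_right, sesqForm_sum_right, sesqForm_smul_right,
            Finset.sum_eq_zero, sesqForm_eq_zero_comm hh hww₀]
          · ring
          · intro j _
            rw [sesqForm_smul_right, sesqForm_eq_zero_comm hh (hwv j), mul_zero]
        refine ⟨(sesqForm g w w₁)⁻¹ • t, fun i => ?_, ?_, ?_⟩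
        · rw [sesqForm_smul_right, htv, mul_zero]
        · rw [sesqForm_smul_right, htw₀, mul_zero]
        · rw [sesqForm_smul_right, htw, inv_mul_cancel₀ hw₁]
      have hw₂w₂ : sesqForm g w₂ w₂ = 0 := hU w₂ hw₂v hw₂w₀
      have hw₀w : sesqForm g w w₀ = 0 := sesqForm_eq_zero_comm hh hww₀
      have hw₀w₂ : sesqForm g w₂ w₀ = 0 := sesqForm_eq_zero_comm hh hw₂w₀
      -- Here `w`, `w₂` is a hyperbolic pair in the alternating complement, which forces
      -- characteristic two. Replacing `w₀` by `w₀ + w` keeps the value `sesqForm g w₀ w₀`, and `w₀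
      -- - sesqForm g w₀ w₀ • w₂` is orthogonal to the new vector with that same nonzero value.
      refine ext (w₀ + w) (fun i => ?_) ?_
        (fun _ => ⟨w₀ - sesqForm g w₀ w₀ • w₂, fun i => ?_, ?_, ?_⟩)
      · rw [sesqForm_add_right, hw₀, hwv, add_zero]
      · rw [sesqForm_add_left, sesqForm_add_right, sesqForm_add_right, hww, hww₀, hw₀w]
        simpa using hw₀a
      · rw [sesqForm_sub_right, sesqForm_smul_right, hw₀, hw₂v, mul_zero, sub_zero]
      · rw [sesqForm_add_left, sesqForm_sub_right, sesqForm_sub_right, sesqForm_smul_right,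
          sesqForm_smul_right, hw₂w₀, hw₀w, hw₂]
        ring
      · rw [sesqForm_sub_left, sesqForm_sub_right, sesqForm_sub_right, sesqForm_smul_left,
          sesqForm_smul_right, sesqForm_smul_right, sesqForm_smul_left, hw₂w₀, hw₀w₂, hw₂w₂]
        simpa using hw₀a

theorem exists_conjTranspose_mul_mul_eq_diagonal (hg : IsUnit g) (hh : gᴴ = g)
    (hna : ∃ v, sesqForm g v v ≠ 0) :
    ∃ (P : Matrix (Fin n) (Fin n) C) (d : Fin n → C), IsUnit P ∧ (∀ i, d i ≠ 0) ∧
      Pᴴ * g * P = diagonal d := by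
  obtain ⟨v, ho, ha, -⟩ := exists_orthogonal_family hg hh hna n le_rfl
  have hP : (of fun i j => v j i)ᴴ * g * (of fun i j => v j i) =
      diagonal fun i => sesqForm g (v i) (v i) := by
    ext i j
    rw [conjTranspose_mul_mul_apply, diagonal_apply]
    by_cases hij : i = j
    · subst hij; simp
    · simpa [hij] using ho i j hij
  refine ⟨of fun i j => v j i, _, ?_, ha, hP⟩
  rw [isUnit_iff_isUnit_det]
  have := congr_arg det hP
  rw [det_mul, det_diagonal] at this
  refine isUnit_of_mul_isUnit_right (x := det ((of fun i j => v j i)ᴴ * g)) ?_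
  rw [this]
  exact (Finset.prod_ne_zero_iff.mpr fun i _ => ha i).isUnit

/-- The standard alternating Gram matrix. -/
abbrev stdAlt (m : ℕ) (C : Type*) [Ring C] : Matrix (Fin m ⊕ Fin m) (Fin m ⊕ Fin m) C :=
  fromBlocks 0 1 (-1) 0

theorem stdAlt_mul_neg (C : Type*) [Field C] (m : ℕ) : stdAlt m C * -stdAlt m C = 1 := by
  simp [stdAlt, fromBlocks_neg, fromBlocks_multiply]

theorem neg_stdAlt_mul (C : Type*) [Field C] (m : ℕ) : -stdAlt m C * stdAlt m C = 1 := by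
  simp [stdAlt, fromBlocks_neg, fromBlocks_multiply]

/-- Families of mutually orthogonal hyperbolic pairs. -/
structure IsHyperbolicFamily (g : Matrix (Fin n) (Fin n) C) {k : ℕ} (e f : Fin k → Fin n → C) :
    Prop where
  ee : ∀ i j, sesqForm g (e i) (e j) = 0
  ff : ∀ i j, sesqForm g (f i) (f j) = 0
  ef : ∀ i j, sesqForm g (e i) (f j) = if i = j then 1 else 0

theorem sesqForm_comm_of_skew (hs : gᴴ = -g) (v w : Fin n → C) :
    sesqForm g w v = - star (sesqForm g v w) := by
  rw [star_sesqForm, hs, sesqForm, sesqForm, neg_mulVec, dotProduct_neg, neg_neg]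

theorem IsHyperbolicFamily.fe (hs : gᴴ = -g) {k : ℕ} {e f : Fin k → Fin n → C}
    (h : IsHyperbolicFamily g e f) (i j : Fin k) :
    sesqForm g (f i) (e j) = if i = j then -1 else 0 := by
  rw [sesqForm_comm_of_skew hs, h.ef]
  by_cases hij : i = j
  · simp [hij]
  · simp [hij, Ne.symm hij]

theorem IsHyperbolicFamily.gram (hs : gᴴ = -g) {k : ℕ} {e f : Fin k → Fin n → C}
    (h : IsHyperbolicFamily g e f) :
    (of fun i j => Sum.elim e f j i)ᴴ * g * (of fun i j => Sum.elim e f j i) = stdAlt k C := by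
  ext (i | i) (j | j) <;> rw [conjTranspose_mul_mul_apply]
  · simpa using h.ee i j
  · simpa [Matrix.one_apply] using h.ef i j
  · have := h.fe hs i j
    by_cases hij : i = j
    · simpa [Matrix.one_apply, hij] using this
    · simpa [Matrix.one_apply, hij] using this
  · simpa using h.ff i j

/-- The Gram matrix is invertible, so the matrix of the `2 k` vectors has a left inverse and its
rank is `2 k`. -/
theorem IsHyperbolicFamily.two_mul_le (hs : gᴴ = -g) {k : ℕ} {e f : Fin k → Fin n → C}
    (h : IsHyperbolicFamily g e f) : 2 * k ≤ n := by
  set P : Matrix (Fin n) (Fin k ⊕ Fin k) C := of fun i j => Sum.elim e f j i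
  have h1 : -stdAlt k C * (Pᴴ * g) * P = 1 := by
    rw [Matrix.mul_assoc, h.gram hs, neg_stdAlt_mul]
  have h3 := (rank_mul_le_right (-stdAlt k C * (Pᴴ * g)) P).trans (rank_le_card_height P)
  rw [h1, rank_one] at h3
  rw [Fintype.card_sum, Fintype.card_fin, Fintype.card_fin] at h3
  omega

theorem IsHyperbolicFamily.exists_succ (hg : IsUnit g) (hs : gᴴ = -g)
    (halt : ∀ v, sesqForm g v v = 0) {k : ℕ} {e f : Fin k → Fin n → C}
    (h : IsHyperbolicFamily g e f) (hk : 2 * k < n) :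
    ∃ e f : Fin (k + 1) → Fin n → C, IsHyperbolicFamily g e f := by
  have comm0 : ∀ {v w : Fin n → C}, sesqForm g v w = 0 → sesqForm g w v = 0 := fun h => by
    rw [sesqForm_comm_of_skew hs, h, star_zero, neg_zero]
  obtain ⟨w, hw0, hw⟩ := exists_ne_zero_forall_sesqForm_eq_zero g (ι := Fin k ⊕ Fin k)
    (by simp; omega) (Sum.elim e f)
  have hwe : ∀ i, sesqForm g (e i) w = 0 := fun i => hw (Sum.inl i)
  have hwf : ∀ i, sesqForm g (f i) w = 0 := fun i => hw (Sum.inr i)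
  obtain ⟨u, hu⟩ : ∃ u, sesqForm g w u ≠ 0 := by
    obtain ⟨u, hu⟩ := exists_sesqForm_ne_zero g hg hw0
    exact ⟨u, fun h => hu (comm0 h)⟩
  obtain ⟨t, hte, htf, htw⟩ : ∃ t, (∀ i, sesqForm g (e i) t = 0) ∧
      (∀ i, sesqForm g (f i) t = 0) ∧ sesqForm g w t = 1 := by
    -- Projection of `u` to the complement of the pairs; the opposite signs reflect that the form is
    -- `1` on `(e i, f i)` and `-1` on `(f i, e i)`.
    set t := u - ∑ i, sesqForm g (e i) u • f i + ∑ i, sesqForm g (f i) u • e i with ht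
    have hexp : ∀ v, sesqForm g v t = sesqForm g v u - ∑ i, sesqForm g (e i) u * sesqForm g v (f i)
        + ∑ i, sesqForm g (f i) u * sesqForm g v (e i) := by
      intro v
      rw [ht, sesqForm_add_right, sesqForm_sub_right, sesqForm_sum_right, sesqForm_sum_right]
      simp only [sesqForm_smul_right]
    refine ⟨(sesqForm g w u)⁻¹ • t, fun i => ?_, fun i => ?_, ?_⟩ <;>
      rw [sesqForm_smul_right, hexp]
    · simp [h.ee, h.ef]
    · simp [h.ff, h.fe hs]
    · simp [comm0 (hwe _), comm0 (hwf _), hu]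
  refine ⟨Fin.snoc e w, Fin.snoc f t, ?_, ?_, ?_⟩ <;> intro i j <;>
    induction i using Fin.lastCases with
    | last =>
      induction j using Fin.lastCases with
      | last => simp [halt, htw]
      | cast j => simp [comm0 (hwe j), comm0 (hwf j), comm0 (htf j), Fin.ext_iff, j.2.ne']
    | cast i =>
      induction j using Fin.lastCases with
      | last => simp [hwe i, hte i, htf i, Fin.ext_iff, i.2.ne]
      | cast j => simp [h.ee, h.ff, h.ef]

theorem exists_conjTranspose_mul_mul_eq_stdAlt (hg : IsUnit g) (hs : gᴴ = -g)
    (halt : ∀ v, sesqForm g v v = 0) :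
    ∃ (m : ℕ) (P : Matrix (Fin n) (Fin m ⊕ Fin m) C), 2 * m = n ∧ Pᴴ * g * P = stdAlt m C := by
  -- Pairs are added until they exhaust the space. Since `2 * k ≤ n`, asking for `n + 1` pairs
  -- forces the process to have stopped.
  have key : ∀ k, (∃ (m : ℕ) (e f : Fin m → Fin n → C), 2 * m = n ∧ IsHyperbolicFamily g e f) ∨
      ∃ e f : Fin k → Fin n → C, IsHyperbolicFamily g e f := by
    intro k
    induction k with
    | zero => exact Or.inr ⟨fun i => i.elim0, fun i => i.elim0, fun i => i.elim0, fun i => i.elim0,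
        fun i => i.elim0⟩
    | succ k ih =>
      rcases ih with ih | ⟨e, f, h⟩
      · exact Or.inl ih
      · rcases (h.two_mul_le hs).eq_or_lt with h1 | h1
        · exact Or.inl ⟨k, e, f, h1, h⟩
        · exact Or.inr (h.exists_succ hg hs halt h1)
  rcases key (n + 1) with ⟨m, e, f, hm, h⟩ | ⟨e, f, h⟩
  · exact ⟨m, _, hm, h.gram hs⟩
  · have := h.two_mul_le hs
    omega

end Matrix

/-! ### Involutions of split algebras as adjoint involutions. -/

theorem Algebra.adjoin_pair_eq_top_of_surjective {F A A' : Type*} [CommRing F] [Ring A] [Ring A']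
    [Algebra F A] [Algebra F A'] (f : A →ₐ[F] A') (hf : Function.Surjective f) {x y : A}
    (h : Algebra.adjoin F {x, y} = ⊤) : Algebra.adjoin F {f x, f y} = ⊤ := by
  have := f.map_adjoin {x, y}
  rw [h, Algebra.map_top, (AlgHom.range_eq_top f).mpr hf, Set.image_pair] at this
  exact this.symm

namespace Matrix

theorem adjoin_conj_pair_eq_top {F C ι κ : Type*} [CommRing F] [CommRing C] [Algebra F C]
    [Fintype ι] [DecidableEq ι] [Fintype κ] [DecidableEq κ]
    {P : Matrix ι κ C} {Q : Matrix κ ι C} (hPQ : P * Q = 1) (hQP : Q * P = 1)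
    {x y : Matrix κ κ C} (h : Algebra.adjoin F {x, y} = ⊤) :
    Algebra.adjoin F {P * x * Q, P * y * Q} = ⊤ := by
  let f : Matrix κ κ C →ₐ[F] Matrix ι ι C := AlgHom.ofLinearMap
    { toFun := fun x => P * x * Q
      map_add' := fun x y => by rw [Matrix.mul_add, Matrix.add_mul]
      map_smul' := fun c x => by rw [Matrix.mul_smul, Matrix.smul_mul]; rfl }
    (by simpa using hPQ)
    (fun x y => by
      change P * (x * y) * Q = P * x * Q * (P * y * Q)
      calc P * (x * y) * Q = P * x * (1 : Matrix κ κ C) * y * Q := by simp [Matrix.mul_assoc]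
        _ = _ := by rw [← hQP]; simp only [Matrix.mul_assoc])
  refine Algebra.adjoin_pair_eq_top_of_surjective f (fun z => ⟨Q * z * P, ?_⟩) h
  change P * (Q * z * P) * Q = z
  calc P * (Q * z * P) * Q = (P * Q) * z * (P * Q) := by simp only [Matrix.mul_assoc]
    _ = z := by rw [hPQ, Matrix.one_mul, Matrix.mul_one]

/-- The Skolem-Noether theorem for split algebras. -/
theorem exists_algEquiv_eq_conj {C : Type*} [Field C] {n : ℕ}
    (α : Matrix (Fin n) (Fin n) C ≃ₐ[C] Matrix (Fin n) (Fin n) C) :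
    ∃ u : Matrix (Fin n) (Fin n) C, IsUnit u ∧ ∀ x, α x = u * x * u⁻¹ := by
  obtain ⟨T, hT⟩ := AlgEquiv.eq_linearEquivConjAlgEquiv
    ((toLinAlgEquiv'.symm.trans α).trans toLinAlgEquiv')
  have h1 : LinearMap.toMatrix' T.toLinearMap * LinearMap.toMatrix' T.symm.toLinearMap = 1 := by
    rw [← LinearMap.toMatrix'_comp]; simp
  have h2 : (LinearMap.toMatrix' T.toLinearMap)⁻¹ = LinearMap.toMatrix' T.symm.toLinearMap :=
    inv_eq_right_inv h1
  refine ⟨LinearMap.toMatrix' T.toLinearMap, IsUnit.of_mul_eq_one _ h1, fun x => ?_⟩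
  have h3 := AlgEquiv.congr_fun hT (toLinAlgEquiv' x)
  have h4 : toLinAlgEquiv' (α x) = T.toLinearMap ∘ₗ toLinAlgEquiv' x ∘ₗ T.symm.toLinearMap := by
    simp only [AlgEquiv.trans_apply, AlgEquiv.symm_apply_apply] at h3
    exact h3
  rw [h2]
  have h5 := congr_arg LinearMap.toMatrix' h4
  rw [LinearMap.toMatrix'_comp, LinearMap.toMatrix'_comp] at h5
  have h6 : ∀ y : Matrix (Fin n) (Fin n) C, LinearMap.toMatrix' (toLinAlgEquiv' y) = y :=
    fun y => LinearMap.toMatrix'_toLin' y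
  rwa [h6, h6, ← Matrix.mul_assoc] at h5

variable {C : Type*} [Field C] [StarRing C] {n : ℕ}

/-- `τ` is a star-semilinear involution of a matrix algebra. -/
structure IsStarInvolution (τ : Matrix (Fin n) (Fin n) C → Matrix (Fin n) (Fin n) C) : Prop where
  map_add : ∀ x y, τ (x + y) = τ x + τ y
  map_smul : ∀ (c : C) x, τ (c • x) = star c • τ x
  map_mul : ∀ x y, τ (x * y) = τ y * τ x
  invol : ∀ x, τ (τ x) = x

/-- Composing `τ` with the conjugate transpose gives a `C`-linear automorphism, which is inner by
Skolem-Noether. That `τ` has order two makes `g⁻¹ * gᴴ` central, hence a scalar `c`. -/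
theorem IsStarInvolution.exists_eq_adjoint
    {τ : Matrix (Fin n) (Fin n) C → Matrix (Fin n) (Fin n) C} (hτ : IsStarInvolution τ) :
    ∃ (g : Matrix (Fin n) (Fin n) C) (c : C), IsUnit g ∧ gᴴ = c • g ∧ ∀ x, τ x = g⁻¹ * xᴴ * g := by
  have map_one : τ 1 = 1 := by
    have := hτ.map_mul (τ 1) 1
    rw [mul_one, hτ.invol, mul_one] at this
    exact this.symm
  let α : Matrix (Fin n) (Fin n) C ≃ₐ[C] Matrix (Fin n) (Fin n) C := AlgEquiv.ofLinearEquiv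
    { toFun := fun x => (τ x)ᴴ
      map_add' := fun x y => by rw [hτ.map_add, conjTranspose_add]
      map_smul' := fun c x => by rw [hτ.map_smul, conjTranspose_smul, star_star]; rfl
      invFun := fun x => τ xᴴ
      left_inv := fun x => by
        change τ (τ x)ᴴᴴ = x
        rw [conjTranspose_conjTranspose, hτ.invol]
      right_inv := fun x => by
        change (τ (τ xᴴ))ᴴ = x
        rw [hτ.invol, conjTranspose_conjTranspose] }
    (by change (τ 1)ᴴ = 1; rw [map_one, conjTranspose_one])
    (fun x y => by
      change (τ (x * y))ᴴ = (τ x)ᴴ * (τ y)ᴴ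
      rw [hτ.map_mul, conjTranspose_mul])
  obtain ⟨u, hu, hα⟩ := exists_algEquiv_eq_conj α
  have hform : ∀ x, τ x = (uᴴ)⁻¹ * xᴴ * uᴴ := by
    intro x
    have h : (τ x)ᴴ = u * x * u⁻¹ := hα x
    have := congr_arg conjTranspose h
    rw [conjTranspose_conjTranspose, conjTranspose_mul, conjTranspose_mul,
      conjTranspose_nonsing_inv] at this
    rw [this, Matrix.mul_assoc]
  have hg : IsUnit uᴴ := hu.star
  generalize uᴴ = g at hform hg
  have hgd : IsUnit g.det := (isUnit_iff_isUnit_det g).mp hg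
  have hgd' : IsUnit gᴴ.det := (isUnit_iff_isUnit_det _).mp hg.star
  have hcomm : ∀ x, g⁻¹ * gᴴ * x = x * (g⁻¹ * gᴴ) := by
    intro x
    have h := hτ.invol x
    rw [hform (τ x), hform x, conjTranspose_mul, conjTranspose_mul, conjTranspose_conjTranspose,
      conjTranspose_nonsing_inv] at h
    calc g⁻¹ * gᴴ * x = g⁻¹ * (gᴴ * (x * (gᴴ)⁻¹)) * g * (g⁻¹ * gᴴ) := by
          rw [Matrix.mul_assoc _ g, mul_nonsing_inv_cancel_left _ _ hgd]
          simp only [Matrix.mul_assoc]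
          rw [nonsing_inv_mul _ hgd', Matrix.mul_one]
      _ = x * (g⁻¹ * gᴴ) := by rw [h]
  obtain ⟨c, hc⟩ := mem_range_scalar_of_commute_single (M := g⁻¹ * gᴴ)
    (fun i j _ => (hcomm (single i j 1)).symm)
  refine ⟨g, c, hg, ?_, hform⟩
  calc gᴴ = g * (g⁻¹ * gᴴ) := by rw [mul_nonsing_inv_cancel_left _ _ hgd]
    _ = c • g := by
      rw [← hc, scalar_apply, ← smul_one_eq_diagonal, Matrix.mul_smul, Matrix.mul_one]

theorem inv_smul_mul_mul_smul {C : Type*} [Field C] {n : ℕ} {c : C} (hc : c ≠ 0)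
    {g : Matrix (Fin n) (Fin n) C} (hg : IsUnit g)
    (y : Matrix (Fin n) (Fin n) C) : (c • g)⁻¹ * y * (c • g) = g⁻¹ * y * g := by
  have hgd : IsUnit g.det := (isUnit_iff_isUnit_det g).mp hg
  have : (c • g)⁻¹ = c⁻¹ • g⁻¹ := by
    refine inv_eq_right_inv ?_
    rw [Matrix.smul_mul, Matrix.mul_smul, smul_smul, mul_inv_cancel₀ hc, one_smul,
      mul_nonsing_inv _ hgd]
  rw [this, Matrix.smul_mul, Matrix.smul_mul, Matrix.mul_smul, smul_smul, inv_mul_cancel₀ hc,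
    one_smul]

/-- An involution of the second kind is adjoint to a nonalternating hermitian form. -/
theorem IsStarInvolution.exists_hermitian
    {τ : Matrix (Fin n) (Fin n) C → Matrix (Fin n) (Fin n) C} (hτ : IsStarInvolution τ)
    (hn : 0 < n) (hstar : ∃ c : C, star c ≠ c) :
    ∃ g : Matrix (Fin n) (Fin n) C, IsUnit g ∧ gᴴ = g ∧ (∃ v, sesqForm g v v ≠ 0) ∧
      ∀ x, τ x = g⁻¹ * xᴴ * g := by
  obtain ⟨g, c, hg, hc, hform⟩ := hτ.exists_eq_adjoint
  -- Hilbert 90: since `c * star c = 1`, rescaling `g` by `b + star b * c` makes it hermitian. If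
  -- this factor vanished for every `b`, then `b = 1` would give `c = -1` and the star would be
  -- trivial.
  obtain ⟨b, hb⟩ : ∃ b : C, b + star b * c ≠ 0 := by
    by_contra! h
    obtain ⟨a, ha⟩ := hstar
    have h1 := h 1
    rw [star_one, one_mul] at h1
    have h2 := h a
    rw [eq_neg_of_add_eq_zero_right h1] at h2
    exact ha (by linear_combination -h2)
  have hdd : c * star c = 1 := by
    have h1 := congr_arg conjTranspose hc
    rw [conjTranspose_conjTranspose, conjTranspose_smul, hc, smul_smul] at h1
    by_contra h
    have h3 : (star c * c - 1) • g = 0 := by rw [sub_smul, one_smul, ← h1, sub_self]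
    have h4 : g = 0 := by
      rcases smul_eq_zero.mp h3 with h4 | h4
      · exact absurd (by linear_combination h4) h
      · exact h4
    have : Nonempty (Fin n) := ⟨⟨0, hn⟩⟩
    exact hg.ne_zero h4
  have hh : ((b + star b * c) • g)ᴴ = (b + star b * c) • g := by
    rw [conjTranspose_smul, hc, smul_smul]
    congr 1
    rw [star_add, star_mul, star_star]
    linear_combination b * hdd
  have hg' : IsUnit ((b + star b * c) • g) := by
    rw [isUnit_iff_isUnit_det, det_smul]
    exact ((isUnit_iff_ne_zero.mpr hb).pow _).mul ((isUnit_iff_isUnit_det g).mp hg)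
  refine ⟨_, hg', hh, ?_, fun x => by rw [hform, inv_smul_mul_mul_smul hb hg]⟩
  generalize (b + star b * c) • g = g at hh hg'
  by_contra! halt
  obtain ⟨a, ha⟩ := hstar
  obtain ⟨v, hv⟩ := exists_sesqForm_ne_zero g hg'
    (w := fun _ => 1) (fun h => one_ne_zero (congr_fun h ⟨0, hn⟩))
  set w : Fin n → C := fun _ => 1
  -- If the form were alternating, polarisation would give `star t = -t` for all `t`. At `t = 1`
  -- this means `-1 = 1`, so the star would be trivial.
  have hskew : ∀ t : C, star t = - t := by
    intro t
    have h1 := halt (v + (t / sesqForm g v w) • w)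
    rw [sesqForm_add_left, sesqForm_add_right, sesqForm_add_right, halt v, sesqForm_smul_right,
      sesqForm_smul_left, sesqForm_smul_left, sesqForm_smul_right, halt w,
      div_mul_cancel₀ _ hv, ← star_star (sesqForm g w v), star_sesqForm, hh, ← star_mul,
      mul_div_cancel₀ _ hv] at h1
    linear_combination h1
  refine ha ?_
  have h2 := hskew 1
  rw [star_one] at h2
  rw [hskew a]
  linear_combination (-a) * h2

/-- Compatibility of adjoint involutions with a change of basis. -/
theorem adjoint_conj {ι : Type*} [Fintype ι] [DecidableEq ι] {g : Matrix (Fin n) (Fin n) C}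
    (hg : IsUnit g) {P : Matrix (Fin n) ι C} {Q : Matrix ι (Fin n) C} {D D' : Matrix ι ι C}
    (hPQ : P * Q = 1) (hD : Pᴴ * g * P = D) (hDD' : D * D' = 1)
    (x : Matrix ι ι C) : g⁻¹ * (P * x * Q)ᴴ * g = P * (D' * xᴴ * D) * Q := by
  have hgd : IsUnit g.det := (isUnit_iff_isUnit_det g).mp hg
  have h1 : Pᴴ * g = D * Q := by
    rw [← hD, Matrix.mul_assoc _ P Q, hPQ, Matrix.mul_one]
  have hPQ' : Qᴴ * Pᴴ = 1 := by rw [← conjTranspose_mul, hPQ, conjTranspose_one]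
  have h2 : g⁻¹ * Qᴴ = P * D' := by
    have h3 : g * P = Qᴴ * D := by
      rw [← hD, ← Matrix.mul_assoc, ← Matrix.mul_assoc, hPQ', Matrix.one_mul]
    calc g⁻¹ * Qᴴ = g⁻¹ * (Qᴴ * D * D') := by rw [Matrix.mul_assoc _ D, hDD', Matrix.mul_one]
      _ = P * D' := by rw [← h3, Matrix.mul_assoc, nonsing_inv_mul_cancel_left _ _ hgd]
  calc g⁻¹ * (P * x * Q)ᴴ * g = (g⁻¹ * Qᴴ) * xᴴ * (Pᴴ * g) := by
        rw [conjTranspose_mul, conjTranspose_mul]; simp only [Matrix.mul_assoc]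
    _ = _ := by rw [h1, h2]; simp only [Matrix.mul_assoc]

/-- In an orthogonal basis the involution is conjugate transpose followed by conjugation with a
diagonal matrix, so it sends `θ + N` to `star θ` plus a lower shift with nonzero weights. -/
theorem exists_adjoin_adjoint_eq_top_of_hermitian {F : Type*} [Field F] [Algebra F C] (θ : C)
    (hθ : Algebra.adjoin F {θ} = ⊤) (hfin : θ = 0 ∨ Finite C) {g : Matrix (Fin n) (Fin n) C}
    (hg : IsUnit g) (hh : gᴴ = g) (hna : ∃ v, sesqForm g v v ≠ 0) :
    ∃ x : Matrix (Fin n) (Fin n) C, Algebra.adjoin F {x, g⁻¹ * xᴴ * g} = ⊤ := by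
  obtain ⟨P, d, hP, hd, hD⟩ := exists_conjTranspose_mul_mul_eq_diagonal hg hh hna
  have hPd : IsUnit P.det := (isUnit_iff_isUnit_det P).mp hP
  -- At `i = 0` the truncated subtraction gives the weight `1`. It is never used, since row `0` of
  -- the lower shift vanishes, but it keeps all weights nonzero.
  let c : Fin n → C := fun i => (d i)⁻¹ * d ⟨i - 1, by omega⟩
  have key := adjoin_conj_pair_eq_top (mul_nonsing_inv _ hPd) (nonsing_inv_mul _ hPd)
    (adjoin_shift_weightedLowerShift (F := F) θ (star θ) c
      (fun i => mul_ne_zero (inv_ne_zero (hd _)) (hd _)) hθ hfin)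
  refine ⟨P * (algebraMap C _ θ + shift n C) * P⁻¹, ?_⟩
  rw [adjoint_conj hg (mul_nonsing_inv _ hPd) hD (D' := diagonal fun i => (d i)⁻¹)]
  · suffices h : (diagonal fun i => (d i)⁻¹) * (algebraMap C _ θ + shift n C)ᴴ * diagonal d =
        algebraMap C _ (star θ) + weightedLowerShift c by rw [h]; exact key
    rw [conjTranspose_add, Matrix.mul_add, Matrix.add_mul]
    congr 1
    · rw [algebraMap_eq_diagonal, algebraMap_eq_diagonal, diagonal_conjTranspose,
        diagonal_mul_diagonal, diagonal_mul_diagonal]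
      congr 1
      ext i
      simp [mul_right_comm, hd i]
    · ext i j
      rw [mul_diagonal, diagonal_mul]
      by_cases hij : (j : ℕ) + 1 = i
      · have : (⟨i - 1, by omega⟩ : Fin n) = j := Fin.ext (by simp; omega)
        simp [shift, weightedLowerShift, hij, c, this]
      · simp [shift, weightedLowerShift, hij]
  · rw [diagonal_mul_diagonal]
    simp [hd]

theorem exists_adjoin_adjoint_eq_top_of_alternating {g : Matrix (Fin n) (Fin n) C}
    (hg : IsUnit g) (hs : gᴴ = -g) (halt : ∀ v, sesqForm g v v = 0) (hn : 2 < n) :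
    ∃ x : Matrix (Fin n) (Fin n) C, Algebra.adjoin C {x, g⁻¹ * xᴴ * g} = ⊤ := by
  obtain ⟨m, P, hm, hP⟩ := exists_conjTranspose_mul_mul_eq_stdAlt hg hs halt
  have hQP : -stdAlt m C * (Pᴴ * g) * P = 1 := by
    rw [Matrix.mul_assoc, hP, neg_stdAlt_mul]
  have hPQ : P * (-stdAlt m C * (Pᴴ * g)) = 1 :=
    (mul_eq_one_comm_of_card_eq _ _ _ (by simp; omega)).mp hQP
  have key := adjoin_conj_pair_eq_top hPQ hQP
    (adjoin_symplectic_eq_top (C := C) (m := m) (by omega))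
  refine ⟨P * fromBlocks 0 (1 : Matrix (Fin m) (Fin m) C) (shift m C) 0 *
    (-stdAlt m C * (Pᴴ * g)), ?_⟩
  rw [adjoint_conj hg hPQ hP (stdAlt_mul_neg C m)]
  have hN : (shift m C)ᴴ = (shift m C)ᵀ := by
    ext i j
    simp only [conjTranspose_apply, transpose_apply, shift, of_apply]
    split_ifs <;> simp
  have h : -stdAlt m C * (fromBlocks 0 (1 : Matrix (Fin m) (Fin m) C) (shift m C) 0)ᴴ * stdAlt m C =
      fromBlocks 0 (-1 : Matrix (Fin m) (Fin m) C) (-(shift m C)ᵀ) 0 := by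
    simp [fromBlocks_conjTranspose, fromBlocks_multiply, fromBlocks_neg, hN]
  rw [h]
  exact key

/-- A linear involution of a split central simple algebra admits a single generator unless it is
symplectic of degree two. -/
theorem exists_adjoin_eq_top_or_symplectic {F : Type*} [Field F] (hn : 0 < n)
    (τ : Matrix (Fin n) (Fin n) F →ₗ[F] Matrix (Fin n) (Fin n) F)
    (hτ : ∀ x y, τ (x * y) = τ y * τ x) (hτ' : ∀ x, τ (τ x) = x) :
    (∃ x, Algebra.adjoin F {x, τ x} = ⊤) ∨
      (n = 2 ∧ ∃ g : Matrix (Fin n) (Fin n) F, IsUnit g ∧ gᵀ = -g ∧ (∀ i, g i i = 0) ∧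
        ∀ x, τ x = g⁻¹ * xᵀ * g) := by
  -- With the trivial star, sesquilinear forms are bilinear and the conjugate transpose is the
  -- transpose.
  let _ : StarRing F := starRingOfComm
  have hstar : ∀ c : F, star c = c := fun _ => rfl
  obtain ⟨g, c, hg, hc, hform⟩ := IsStarInvolution.exists_eq_adjoint (C := F) (τ := τ)
    ⟨map_add τ, fun c x => by rw [map_smul, hstar], hτ, hτ'⟩
  have hne : g ≠ 0 := by
    have : Nonempty (Fin n) := ⟨⟨0, hn⟩⟩
    exact hg.ne_zero
  have hcc : c = 1 ∨ c = -1 := by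
    have h1 := congr_arg conjTranspose hc
    rw [conjTranspose_conjTranspose, conjTranspose_smul, hc, smul_smul, hstar] at h1
    have h3 : (c * c - 1) • g = 0 := by rw [sub_smul, one_smul, ← h1, sub_self]
    rcases smul_eq_zero.mp h3 with h4 | h4
    · exact mul_self_eq_one_iff.mp (sub_eq_zero.mp h4)
    · exact absurd h4 hne
  by_cases hna : ∃ v, sesqForm g v v ≠ 0
  · left
    have hh : gᴴ = g := by
      rcases hcc with rfl | rfl
      · rw [hc, one_smul]
      -- A skew form with `sesqForm g v v ≠ 0` forces `2 = 0`, so it is symmetric as well.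
      · obtain ⟨v, hv⟩ := hna
        have h1 := star_sesqForm g v v
        rw [hc, neg_one_smul, hstar, sesqForm, sesqForm, neg_mulVec, dotProduct_neg] at h1
        have h2 : (-1 : F) = 1 := by
          have : (2 : F) * sesqForm g v v = 0 := by rw [sesqForm]; linear_combination h1
          have := (mul_eq_zero.mp this).resolve_right hv
          linear_combination -this
        rw [hc, h2, one_smul]
    obtain ⟨x, hx⟩ := exists_adjoin_adjoint_eq_top_of_hermitian (F := F) (0 : F)
      (Subsingleton.elim _ _) (Or.inl rfl) hg hh hna
    exact ⟨x, by rwa [hform]⟩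
  · push Not at hna
    have hskew : gᴴ = -g := by
      ext i j
      have h1 := hna (Pi.single i 1 + Pi.single j 1)
      rw [sesqForm_add_left, sesqForm_add_right, sesqForm_add_right, hna, hna] at h1
      have h2 : ∀ a b, sesqForm g (Pi.single a 1) (Pi.single b 1) = g a b := by
        intro a b
        simp [sesqForm, hstar]
      rw [h2, h2] at h1
      simp only [conjTranspose_apply, neg_apply, hstar]
      linear_combination h1
    by_cases hn2 : 2 < n
    · left
      obtain ⟨x, hx⟩ := exists_adjoin_adjoint_eq_top_of_alternating hg hskew hna hn2
      exact ⟨x, by rwa [hform]⟩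
    -- A nondegenerate alternating form lives in even dimension, so `0 < n ≤ 2` leaves only `n = 2`.
    · right
      obtain ⟨m, P, hm, -⟩ := exists_conjTranspose_mul_mul_eq_stdAlt hg hskew hna
      refine ⟨by omega, g, hg, hskew, fun i => ?_, hform⟩
      have := hna (Pi.single i 1)
      simpa [sesqForm, hstar] using this

end Matrix

/-! ### Linear data of an Azumaya algebra with involution, stable under base change. -/

/-- The span of the endomorphisms `b ↦ x * b * y`. -/
def sandwichMaps (R : Type*) (B : Type*) [CommRing R] [Ring B] [Algebra R B] :
    Submodule R (Module.End R B) :=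
  Submodule.span R (Set.range (LinearMap.mulLeftRight R : B × B → Module.End R B))

section sandwichMaps

variable {R : Type*} {B : Type*} [CommRing R] [Ring B] [Algebra R B]

theorem sandwichMaps_apply_mem {f : Module.End R B} (hf : f ∈ sandwichMaps R B)
    (P : Submodule R B) (hP : ∀ x y, ∀ b ∈ P, x * b * y ∈ P) {b : B} (hb : b ∈ P) : f b ∈ P := by
  induction hf using Submodule.span_induction with
  | mem f h => obtain ⟨⟨x, y⟩, rfl⟩ := h; exact hP x y b hb
  | zero => exact P.zero_mem
  | add f g _ _ hf hg => exact P.add_mem hf hg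
  | smul r f _ hf => exact P.smul_mem r hf

theorem sandwichMaps_apply_center_mul {f : Module.End R B} (hf : f ∈ sandwichMaps R B)
    {c : B} (hc : c ∈ Subalgebra.center R B) (b : B) : f (c * b) = c * f b := by
  induction hf using Submodule.span_induction with
  | mem f h =>
    obtain ⟨⟨x, y⟩, rfl⟩ := h
    simp only [LinearMap.mulLeftRight_apply]
    rw [← mul_assoc, Subalgebra.mem_center_iff.mp hc x]
    simp only [mul_assoc]
  | zero => simp
  | add f g _ _ hf hg => simp [hf, hg, mul_add]
  | smul r f _ hf => simp [hf]

theorem sandwichMaps_baseChange (A : Type*) [CommRing A] [Algebra R A] {f : Module.End R B}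
    (hf : f ∈ sandwichMaps R B) : f.baseChange A ∈ sandwichMaps A (A ⊗[R] B) := by
  induction hf using Submodule.span_induction with
  | mem f h =>
    obtain ⟨⟨x, y⟩, rfl⟩ := h
    refine Submodule.subset_span ⟨(1 ⊗ₜ x, 1 ⊗ₜ y), ?_⟩
    ext b
    simp
  | zero => rw [LinearMap.baseChange_zero]; exact Submodule.zero_mem _
  | add f g _ _ hf hg => rw [LinearMap.baseChange_add]; exact Submodule.add_mem _ hf hg
  | smul r f _ hf =>
    rw [LinearMap.baseChange_smul]
    have := Submodule.smul_mem _ (algebraMap R A r) hf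
    rwa [algebraMap_smul] at this

end sandwichMaps

/-- Elementary consequences of `IsAzumayaWithInvolution` which are stable under base change and
suffice over fields. -/
structure AzumayaInvolutionData (R : Type*) {B : Type*} [CommRing R] [Ring B] [Algebra R B]
    (τ : B →ₗ[R] B) : Prop where
  finite : Module.Finite R B
  isAlgInvolution : IsAlgInvolution R τ
  exists_retraction : ∃ π ∈ sandwichMaps R B, (∀ b, π b ∈ Subalgebra.center R B) ∧ π 1 = 1
  exists_dualBasis : ∃ (n : ℕ) (b : Fin n → B) (π : Fin n → Module.End R B),
    (∀ i, π i ∈ sandwichMaps R B) ∧ (∀ i x, π i x ∈ Subalgebra.center R B) ∧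
      ∀ x, x = ∑ i, π i x * b i
  trace_mem : ∀ z ∈ Subalgebra.center R B, z + τ z ∈ (⊥ : Subalgebra R B)
  -- Where `f` is invertible the center is the base ring, so the involution is of the first kind.
  -- Where `f` vanishes, the elements `τ z - z` generate the unit ideal of the center, so the
  -- involution moves it freely.
  exists_idempotent : ∃ f : R, (∀ z ∈ Subalgebra.center R B, f • z ∈ (⊥ : Subalgebra R B)) ∧
    algebraMap R B (1 - f) ∈ Submodule.span R
      {w | ∃ a ∈ Subalgebra.center R B, ∃ z ∈ Subalgebra.center R B, w = a * (τ z - z)}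

section baseChange

variable {R : Type*} {B : Type*} [CommRing R] [Ring B] [Algebra R B]
variable (A : Type*) [CommRing A] [Algebra R A]

theorem one_tmul_algebraMap (r : R) :
    (1 : A) ⊗ₜ[R] algebraMap R B r = algebraMap A (A ⊗[R] B) (algebraMap R A r) := by
  rw [Algebra.TensorProduct.algebraMap_apply, Algebra.algebraMap_self_apply,
    Algebra.algebraMap_eq_smul_one, Algebra.algebraMap_eq_smul_one, TensorProduct.smul_tmul]

theorem one_tmul_mem_center {z : B} (hz : z ∈ Subalgebra.center R B) :
    (1 : A) ⊗ₜ[R] z ∈ Subalgebra.center A (A ⊗[R] B) := by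
  refine Subalgebra.mem_center_iff.mpr fun y => ?_
  induction y with
  | zero => simp
  | tmul a b => simp [Subalgebra.mem_center_iff.mp hz b]
  | add x y hx hy => rw [add_mul, mul_add, hx, hy]

theorem baseChange_apply_mem_span {π : Module.End R B} {s : Set B} (h : ∀ b, π b ∈ s)
    (y : A ⊗[R] B) : π.baseChange A y ∈ Submodule.span A ((fun z => (1 : A) ⊗ₜ[R] z) '' s) := by
  induction y with
  | zero => simp
  | tmul a b =>
    rw [LinearMap.baseChange_tmul, ← mul_one a, ← smul_eq_mul, ← TensorProduct.smul_tmul']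
    exact Submodule.smul_mem _ _ (Submodule.subset_span ⟨_, h b, rfl⟩)
  | add x y hx hy => rw [map_add]; exact Submodule.add_mem _ hx hy

theorem span_one_tmul_center_le :
    Submodule.span A ((fun z => (1 : A) ⊗ₜ[R] z) '' (Subalgebra.center R B : Set B)) ≤
      Subalgebra.toSubmodule (Subalgebra.center A (A ⊗[R] B)) := by
  rw [Submodule.span_le]
  rintro _ ⟨z, hz, rfl⟩
  exact one_tmul_mem_center A hz

/-- The center is compatible with base change because `π` remains linear over the center: a central
`y` equals `y * π 1 = π y`, and the image of `π` is spanned by the old center. -/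
theorem mem_span_one_tmul_center {π : Module.End R B} (hπ : π ∈ sandwichMaps R B)
    (hc : ∀ b, π b ∈ Subalgebra.center R B) (h1 : π 1 = 1) {y : A ⊗[R] B}
    (hy : y ∈ Subalgebra.center A (A ⊗[R] B)) :
    y ∈ Submodule.span A ((fun z => (1 : A) ⊗ₜ[R] z) '' (Subalgebra.center R B : Set B)) := by
  have h2 : π.baseChange A y = y := by
    have := sandwichMaps_apply_center_mul (sandwichMaps_baseChange A hπ) hy 1
    rwa [mul_one, Algebra.TensorProduct.one_def, LinearMap.baseChange_tmul, h1,
      ← Algebra.TensorProduct.one_def, mul_one] at this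
  rw [← h2]
  exact baseChange_apply_mem_span A hc y

theorem IsAlgInvolution.baseChange {τ : B →ₗ[R] B} (h : IsAlgInvolution R τ) :
    IsAlgInvolution A (τ.baseChange A) where
  map_mul_rev x y := by
    induction x with
    | zero => simp
    | add x x' hx hx' => rw [add_mul, map_add, map_add, mul_add, hx, hx']
    | tmul a b =>
      induction y with
      | zero => simp
      | add y y' hy hy' => rw [mul_add, map_add, map_add, add_mul, hy, hy']
      | tmul a' b' => simp [h.map_mul_rev, mul_comm]
  involutive x := by
    induction x with
    | zero => simp
    | add x x' hx hx' => rw [map_add, map_add, hx, hx']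
    | tmul a b => simp [h.involutive]

theorem AzumayaInvolutionData.baseChange {τ : B →ₗ[R] B} (h : AzumayaInvolutionData R τ) :
    AzumayaInvolutionData A (τ.baseChange A) := by
  obtain ⟨π, hπ, hπc, hπ1⟩ := h.exists_retraction
  have hcenter : ∀ y ∈ Subalgebra.center A (A ⊗[R] B), y ∈ Submodule.span A
      ((fun z => (1 : A) ⊗ₜ[R] z) '' (Subalgebra.center R B : Set B)) := fun y hy =>
    mem_span_one_tmul_center A hπ hπc hπ1 hy
  have hbot : ∀ x ∈ (⊥ : Subalgebra R B), (1 : A) ⊗ₜ[R] x ∈ (⊥ : Subalgebra A (A ⊗[R] B)) := by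
    intro x hx
    obtain ⟨r, rfl⟩ := Algebra.mem_bot.mp hx
    exact Algebra.mem_bot.mpr ⟨algebraMap R A r, (one_tmul_algebraMap A r).symm⟩
  refine ⟨?_, h.isAlgInvolution.baseChange A, ?_, ?_, ?_, ?_⟩
  · have := h.finite
    infer_instance
  · refine ⟨π.baseChange A, sandwichMaps_baseChange A hπ, fun y => ?_, ?_⟩
    · exact span_one_tmul_center_le A (baseChange_apply_mem_span A hπc y)
    · rw [Algebra.TensorProduct.one_def, LinearMap.baseChange_tmul, hπ1]
  · obtain ⟨n, b, p, hp, hpc, hb⟩ := h.exists_dualBasis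
    refine ⟨n, fun i => 1 ⊗ₜ b i, fun i => (p i).baseChange A,
      fun i => sandwichMaps_baseChange A (hp i),
      fun i y => span_one_tmul_center_le A (baseChange_apply_mem_span A (hpc i) y), fun y => ?_⟩
    induction y with
    | zero => simp
    | add x y hx hy =>
      simp only [map_add, add_mul, Finset.sum_add_distrib]
      rw [← hx, ← hy]
    | tmul a x =>
      simp only [LinearMap.baseChange_tmul, Algebra.TensorProduct.tmul_mul_tmul, mul_one]
      rw [← TensorProduct.tmul_sum, ← hb x]
  · intro z hz
    have hz' := hcenter z hz
    clear hz
    induction hz' using Submodule.span_induction with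
    | mem x hx =>
      obtain ⟨z, hz, rfl⟩ := hx
      rw [LinearMap.baseChange_tmul, ← TensorProduct.tmul_add]
      exact hbot _ (h.trace_mem z hz)
    | zero => simp
    | add x y _ _ ihx ihy =>
      rw [map_add, add_add_add_comm]
      exact Subalgebra.add_mem _ ihx ihy
    | smul a x _ ih =>
      rw [map_smul, ← smul_add]
      exact Subalgebra.smul_mem _ ih a
  · obtain ⟨f, hf, hspan⟩ := h.exists_idempotent
    refine ⟨algebraMap R A f, fun z hz => ?_, ?_⟩
    · have hz' := hcenter z hz
      clear hz
      induction hz' using Submodule.span_induction with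
      | mem x hx =>
        obtain ⟨z, hz, rfl⟩ := hx
        simp only [algebraMap_smul]
        rw [TensorProduct.smul_tmul', TensorProduct.smul_tmul]
        exact hbot _ (hf z hz)
      | zero => simp
      | add x y _ _ ihx ihy => rw [smul_add]; exact Subalgebra.add_mem _ ihx ihy
      | smul a x _ ih => rw [smul_comm]; exact Subalgebra.smul_mem _ ih a
    · have h1 : algebraMap A (A ⊗[R] B) (1 - algebraMap R A f) =
          (1 : A) ⊗ₜ[R] algebraMap R B (1 - f) := by
        rw [one_tmul_algebraMap, map_sub (algebraMap R A), map_one]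
      rw [h1]
      generalize algebraMap R B (1 - f) = w at hspan
      induction hspan using Submodule.span_induction with
      | mem w hw =>
        obtain ⟨a, ha, z, hz, rfl⟩ := hw
        refine Submodule.subset_span ⟨1 ⊗ₜ a, one_tmul_mem_center A ha, 1 ⊗ₜ z,
          one_tmul_mem_center A hz, ?_⟩
        rw [LinearMap.baseChange_tmul, ← TensorProduct.tmul_sub,
          Algebra.TensorProduct.tmul_mul_tmul, one_mul]
      | zero => simp
      | add x y _ _ ihx ihy => rw [TensorProduct.tmul_add]; exact Submodule.add_mem _ ihx ihy
      | smul r x _ ih =>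
        have := Submodule.smul_mem _ (algebraMap R A r) ih
        rwa [algebraMap_smul, TensorProduct.smul_tmul', TensorProduct.smul_tmul] at this

end baseChange

/-! ### Extracting the data from the Azumaya and étale hypotheses. -/

section ofIsAzumaya

variable {R : Type u} {B : Type v} [CommRing R] [Ring B] [Algebra R B]

theorem IsAlgInvolution.map_one {τ : B →ₗ[R] B} (h : IsAlgInvolution R τ) : τ 1 = 1 := by
  have := h.map_mul_rev (τ 1) 1
  rw [mul_one, h.involutive, mul_one] at this
  exact this.symm

theorem IsAlgInvolution.map_mem_center {τ : B →ₗ[R] B} (h : IsAlgInvolution R τ) {z : B}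
    (hz : z ∈ Subalgebra.center R B) : τ z ∈ Subalgebra.center R B := by
  refine Subalgebra.mem_center_iff.mpr fun b => ?_
  rw [← h.involutive b, ← h.map_mul_rev, ← h.map_mul_rev, Subalgebra.mem_center_iff.mp hz]

/-- The restriction of an involution to the center. -/
def centerInvolution {τ : B →ₗ[R] B} (h : IsAlgInvolution R τ) :
    Subalgebra.center R B →ₐ[R] Subalgebra.center R B :=
  AlgHom.ofLinearMap
    (τ.restrict (p := Subalgebra.toSubmodule (Subalgebra.center R B))
      (q := Subalgebra.toSubmodule (Subalgebra.center R B)) fun _ hz => h.map_mem_center hz)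
    (Subtype.ext h.map_one)
    (fun x y => Subtype.ext ((h.map_mul_rev x y).trans
      (Subalgebra.mem_center_iff.mp (h.map_mem_center x.2) _)))

theorem centerInvolution_involutive {τ : B →ₗ[R] B} (h : IsAlgInvolution R τ)
    (z : Subalgebra.center R B) : centerInvolution h (centerInvolution h z) = z :=
  Subtype.ext (h.involutive z)

open Algebra in
/-- An automorphism of order two of an unramified algebra is the identity on a direct factor, and
moves points freely on the complementary factor. -/
theorem exists_fixed_of_formallyUnramified {Z : Type*} [CommRing Z] [Algebra R Z]
    [Module.Finite R Z] [FormallyUnramified R Z] (σ : Z →ₐ[R] Z) (hσ : ∀ z, σ (σ z) = z) :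
    ∃ f : Z, σ f = f ∧ (∀ z, f * σ z = f * z) ∧
      1 - f ∈ Submodule.span R {w | ∃ a z : Z, w = a * (σ z - z)} := by
  -- A separability element of `Z`; its image under `a ⊗ b ↦ σ a * b` is the required `f`.
  obtain ⟨t, ht, ht1⟩ := FormallyUnramified.iff_exists_tensorProduct.mp
    (inferInstance : FormallyUnramified R Z)
  set I := Submodule.span R {w | ∃ a z : Z, w = a * (σ z - z)} with hI
  let μ : Z ⊗[R] Z →ₐ[R] Z := Algebra.TensorProduct.productMap σ (AlgHom.id R Z)
  have hfz : ∀ z, (z - σ z) * μ t = 0 := by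
    intro z
    have := congr_arg μ (ht z)
    simpa [μ] using this
  have hmem : ∀ s : Z ⊗[R] Z, TensorProduct.lmul' R s - μ s ∈ I := by
    intro s
    induction s with
    | zero => simp
    | add x y hx hy =>
      rw [map_add, map_add, add_sub_add_comm]
      exact I.add_mem hx hy
    | tmul x y =>
      rw [← neg_sub]
      refine I.neg_mem (Submodule.subset_span ⟨y, x, ?_⟩)
      simp only [μ, Algebra.TensorProduct.productMap_apply_tmul, AlgHom.id_apply,
        TensorProduct.lmul'_apply_tmul]
      ring
  have h1f : 1 - μ t ∈ I := ht1 ▸ hmem t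
  have hIf : ∀ w ∈ I, w * μ t = 0 := by
    intro w hw
    induction hw using Submodule.span_induction with
    | mem w h =>
      obtain ⟨a, z, rfl⟩ := h
      linear_combination (-a) * hfz z
    | zero => rw [zero_mul]
    | add x y _ _ hx hy => rw [add_mul, hx, hy, add_zero]
    | smul r x _ hx => rw [smul_mul_assoc, hx, smul_zero]
  have hIσ : ∀ w ∈ I, σ w ∈ I := by
    intro w hw
    induction hw using Submodule.span_induction with
    | mem w h =>
      obtain ⟨a, z, rfl⟩ := h
      exact Submodule.subset_span ⟨σ a, σ z, by rw [map_mul, map_sub]⟩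
    | zero => rw [map_zero]; exact I.zero_mem
    | add x y _ _ hx hy => rw [map_add]; exact I.add_mem hx hy
    | smul r x _ hx => rw [map_smul]; exact I.smul_mem r hx
  -- The span `I` is stable under `σ` and killed by `f`. As `1 - σ f` lies in `I`, one gets `f = σ f
  -- * f`, which is symmetric under `σ`.
  have h2 : μ t = σ (μ t) * μ t := by
    have := hIf _ (hIσ _ h1f)
    rw [map_sub, map_one] at this
    linear_combination this
  refine ⟨μ t, ?_, fun z => by linear_combination -hfz z, h1f⟩
  have h3 := congr_arg σ h2
  rw [map_mul, hσ] at h3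
  rw [h3, mul_comm, ← h2]

/-- A finite projective faithful module is a generator. -/
theorem exists_linearMap_apply_one_eq_one {Z : Type*} [CommRing Z] [Algebra Z B]
    [Module.Finite Z B] [FaithfulSMul Z B] {n : ℕ} (b : Fin n → B) (f : Fin n → B →ₗ[Z] Z)
    (hb : ∀ x, x = ∑ i, f i x • b i) : ∃ φ : B →ₗ[Z] Z, φ 1 = 1 := by
  let T : Ideal Z := LinearMap.range
    ({ toFun := fun φ => φ 1, map_add' := fun _ _ => rfl, map_smul' := fun _ _ => rfl } :
      (B →ₗ[Z] Z) →ₗ[Z] Z)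
  have hT : ∀ i x, f i x ∈ T := fun i x =>
    ⟨(f i).comp (LinearMap.mulRight Z x), by simp⟩
  -- `T` is the trace ideal of `B`, and the dual basis gives `B = T B`. By Nakayama some element of
  -- `1 + T` kills the faithful module `B`, hence is zero.
  have hle : (⊤ : Submodule Z B) ≤ T • ⊤ := by
    intro x _
    rw [hb x]
    exact Submodule.sum_mem _ fun i _ => Submodule.smul_mem_smul (hT i x) Submodule.mem_top
  obtain ⟨r, hr, hr0⟩ := Submodule.exists_sub_one_mem_and_smul_eq_zero_of_fg_of_le_smul T ⊤
    Module.Finite.fg_top hle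
  have : r = 0 := by
    refine FaithfulSMul.eq_of_smul_eq_smul (α := B) fun x => ?_
    rw [hr0 x Submodule.mem_top, zero_smul]
  rw [this, zero_sub] at hr
  have h1 : (1 : Z) ∈ T := by simpa using T.neg_mem hr
  exact h1

theorem mulLeftRight_restrictScalars_mem_sandwichMaps
    (t : B ⊗[Subalgebra.center R B] Bᵐᵒᵖ) :
    (AlgHom.mulLeftRight (Subalgebra.center R B) B t).restrictScalars R ∈ sandwichMaps R B := by
  induction t with
  | zero => rw [map_zero]; exact Submodule.zero_mem _
  | add x y hx hy => rw [map_add]; exact Submodule.add_mem _ hx hy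
  | tmul x y =>
    refine Submodule.subset_span ⟨(x, y.unop), ?_⟩
    ext b
    simp

/-- By the Azumaya property every endomorphism of `B` linear over its center is a sandwich map, so
functionals and dual bases of the projective module `B` take the required form. Traces and the
element `f` are fixed by `τ` and central, hence come from `R`. -/
theorem IsAzumayaWithInvolution.azumayaInvolutionData {τ : B →ₗ[R] B}
    (h : IsAzumayaWithInvolution R τ) : AzumayaInvolutionData R τ := by
  have hinv := h.isAlgInvolution
  have := h.isAzumaya_center
  have := h.finite_center
  have := h.etale_center
  have hproj : Module.Projective (Subalgebra.center R B) B := h.isAzumaya_center.toProjective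
  have hfin : Module.Finite (Subalgebra.center R B) B := h.isAzumaya_center.toFinite
  have hfaith : FaithfulSMul (Subalgebra.center R B) B := h.isAzumaya_center.toFaithfulSMul
  have : IsScalarTower R (Subalgebra.center R B) B := ⟨fun r z b => by
    rw [Algebra.smul_def (z : Subalgebra.center R B), Algebra.smul_def (r • z)]
    exact smul_mul_assoc r (z : B) b⟩
  have hsandwich : ∀ f : B →ₗ[Subalgebra.center R B] Subalgebra.center R B,
      ∃ π ∈ sandwichMaps R B, ∀ x, π x = f x := by
    intro f
    obtain ⟨t, ht⟩ := h.isAzumaya_center.bij.2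
      ((Algebra.linearMap (Subalgebra.center R B) B).comp f)
    refine ⟨_, mulLeftRight_restrictScalars_mem_sandwichMaps t, fun x => ?_⟩
    rw [ht]
    rfl
  obtain ⟨n, p, q, -, -, hpq⟩ := Module.Finite.exists_comp_eq_id_of_projective
    (Subalgebra.center R B) B
  have hbasis : ∀ x, x = ∑ i, (LinearMap.proj i ∘ₗ q) x • p (fun j => if i = j then 1 else 0) := by
    intro x
    conv_lhs => rw [← LinearMap.id_apply (R := Subalgebra.center R B) x, ← hpq,
      LinearMap.comp_apply, LinearMap.pi_apply_eq_sum_univ p (q x)]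
    rfl
  refine ⟨Module.Finite.trans (Subalgebra.center R B) B, hinv, ?_, ?_, ?_, ?_⟩
  · obtain ⟨φ, hφ⟩ := exists_linearMap_apply_one_eq_one _ _ hbasis
    obtain ⟨π, hπ, hπφ⟩ := hsandwich φ
    exact ⟨π, hπ, fun b => hπφ b ▸ (φ b).2, by rw [hπφ, hφ]; rfl⟩
  · choose π hπ hπf using fun i => hsandwich (LinearMap.proj i ∘ₗ q)
    refine ⟨n, fun i => p (fun j => if i = j then 1 else 0), π, hπ,
      fun i x => by rw [hπf]; exact Subtype.prop _,
      fun x => ?_⟩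
    simp only [hπf]
    exact hbasis x
  · intro z hz
    have : z + τ z ∈ Set.range (algebraMap R B) := by
      rw [h.range_algebraMap]
      refine ⟨Subalgebra.add_mem _ hz (hinv.map_mem_center hz), ?_⟩
      rw [map_add, hinv.involutive, add_comm]
    exact this
  · obtain ⟨f, hf1, hf2, hf3⟩ := exists_fixed_of_formallyUnramified (centerInvolution hinv)
      (centerInvolution_involutive hinv)
    have hf1' : τ (f : B) = f := congr_arg Subtype.val hf1
    obtain ⟨r, hr⟩ : (f : B) ∈ Set.range (algebraMap R B) := by
      rw [h.range_algebraMap]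
      exact ⟨f.2, hf1'⟩
    refine ⟨r, fun z hz => ?_, ?_⟩
    · have : r • z ∈ Set.range (algebraMap R B) := by
        rw [h.range_algebraMap]
        refine ⟨Subalgebra.smul_mem _ hz r, ?_⟩
        rw [map_smul, Algebra.smul_def, Algebra.smul_def, hr]
        exact congr_arg Subtype.val (hf2 ⟨z, hz⟩)
      exact this
    · rw [map_sub, map_one, hr]
      have := Submodule.mem_map_of_mem (f := (Subalgebra.center R B).val.toLinearMap) hf3
      rw [Submodule.map_span] at this
      refine Submodule.span_mono ?_ this
      rintro _ ⟨_, ⟨a, z, rfl⟩, rfl⟩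
      exact ⟨a, a.2, z, z.2, rfl⟩

end ofIsAzumaya

/-! ### Fibres over finite and algebraically closed fields. -/

/-- A finite-dimensional central simple algebra over a finite or algebraically closed field is
split. -/
theorem exists_algEquiv_matrix_of_finite_or_isAlgClosed {F A : Type*} [Field F]
    (hF : Finite F ∨ IsAlgClosed F) [Ring A] [Algebra F A] [IsSimpleRing A] [Module.Finite F A]
    (hc : ∀ a ∈ Subalgebra.center F A, a ∈ (⊥ : Subalgebra F A)) :
    ∃ n, 0 < n ∧ Nonempty (A ≃ₐ[F] Matrix (Fin n) (Fin n) F) := by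
  rcases hF with hF | hF
  · have := IsArtinianRing.of_finite F A
    obtain ⟨n, hn, D, _, _, _, ⟨φ⟩⟩ := IsSimpleRing.exists_algEquiv_matrix_divisionRing_finite F A
    have hD : Finite D := Module.finite_of_finite F
    have hcomm : ∀ x y : D, x * y = y * x := (littleWedderburn D).mul_comm
    have hbij : Function.Bijective (Algebra.ofId F D) := by
      refine ⟨(algebraMap F D).injective, fun x => ?_⟩
      have hx : φ.symm (Matrix.scalar (Fin n) x) ∈ Subalgebra.center F A := by
        refine Subalgebra.mem_center_iff.mpr fun a => φ.injective ?_
        rw [map_mul, map_mul, AlgEquiv.apply_symm_apply]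
        exact ((Matrix.scalar_commute x (fun y => hcomm x y) (φ a)).eq).symm
      obtain ⟨r, hr⟩ := Algebra.mem_bot.mp (hc _ hx)
      refine ⟨r, ?_⟩
      have h1 := congr_arg φ hr
      rw [AlgEquiv.commutes, AlgEquiv.apply_symm_apply] at h1
      have h2 := congr_fun (congr_fun h1 0) 0
      simpa [Matrix.algebraMap_matrix_apply] using h2
    exact ⟨n, Nat.pos_of_ne_zero hn.out, ⟨φ.trans (AlgEquiv.ofBijective _ hbij).symm.mapMatrix⟩⟩
  · obtain ⟨n, hn, h⟩ := IsSimpleRing.exists_algEquiv_matrix_of_isAlgClosed F A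
    exact ⟨n, Nat.pos_of_ne_zero hn.out, h⟩

namespace AzumayaInvolutionData

variable {F B : Type*} [Field F] [Ring B] [Algebra F B] {τ : B →ₗ[F] B}

theorem map_mul_center (h : AzumayaInvolutionData F τ) (x : B) {y : B}
    (hy : y ∈ Subalgebra.center F B) : τ (x * y) = τ x * τ y := by
  rw [h.isAlgInvolution.map_mul_rev,
    Subalgebra.mem_center_iff.mp (h.isAlgInvolution.map_mem_center hy)]

theorem mem_bot_or_span (h : AzumayaInvolutionData F τ) :
    (∀ z ∈ Subalgebra.center F B, z ∈ (⊥ : Subalgebra F B)) ∨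
      (1 : B) ∈ Submodule.span F
        {w | ∃ a ∈ Subalgebra.center F B, ∃ z ∈ Subalgebra.center F B, w = a * (τ z - z)} := by
  obtain ⟨f, hf, hf1⟩ := h.exists_idempotent
  by_cases hf0 : f = 0
  · right
    rwa [hf0, sub_zero, map_one] at hf1
  · left
    intro z hz
    have := Subalgebra.smul_mem _ (hf z hz) f⁻¹
    rwa [smul_smul, inv_mul_cancel₀ hf0, one_smul] at this

/-- In the second case some central `t` has trace `1`, so that `c = c * t + τ (c * t)` is a trace.
If all traces vanished, then `2 = 0` and `τ` would be the identity on the center, against `1` lying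
in the span. -/
theorem mem_bot_of_fixed [Nontrivial B] (h : AzumayaInvolutionData F τ) {c : B}
    (hc : c ∈ Subalgebra.center F B) (hτ : τ c = c) : c ∈ (⊥ : Subalgebra F B) := by
  rcases h.mem_bot_or_span with h1 | h1
  · exact h1 c hc
  obtain ⟨t, ht, htt⟩ : ∃ t ∈ Subalgebra.center F B, t + τ t = 1 := by
    obtain ⟨t, ht, ht0⟩ : ∃ t ∈ Subalgebra.center F B, t + τ t ≠ 0 := by
      by_contra! h0
      have h2 : (1 : B) + 1 = 0 := by
        have := h0 1 (Subalgebra.one_mem _)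
        rwa [h.isAlgInvolution.map_one] at this
      have hle : Submodule.span F
          {w | ∃ a ∈ Subalgebra.center F B, ∃ z ∈ Subalgebra.center F B, w = a * (τ z - z)} ≤
          ⊥ := by
        rw [Submodule.span_le]
        rintro _ ⟨a, ha, z, hz, rfl⟩
        have h3 : τ z - z = 0 := by
          rw [eq_neg_of_add_eq_zero_right (h0 z hz), ← neg_add', ← mul_one (z + z), add_mul,
            ← mul_add, h2, mul_zero, neg_zero]
        simp [h3]
      exact one_ne_zero (hle h1)
    obtain ⟨r, hr⟩ := Algebra.mem_bot.mp (h.trace_mem t ht)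
    have hr0 : r ≠ 0 := fun h0 => ht0 (by rw [← hr, h0, map_zero])
    refine ⟨r⁻¹ • t, Subalgebra.smul_mem _ ht _, ?_⟩
    rw [map_smul, ← smul_add, ← hr, Algebra.algebraMap_eq_smul_one, smul_smul,
      inv_mul_cancel₀ hr0, one_smul]
  have h2 : c = c * t + τ (c * t) := by
    rw [h.map_mul_center c ht, hτ, ← mul_add, htt, mul_one]
  rw [h2]
  exact h.trace_mem _ (Subalgebra.mul_mem _ hc ht)

/-- The trace of a central square-zero `w` is a nilpotent scalar, so `τ w = -w`. For `w = c` and `w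
= c * z` this gives `c * (τ z - z) = 0`, and `1` is a combination of multiples of such differences.
-/
theorem eq_zero_of_mul_self [Nontrivial B] (h : AzumayaInvolutionData F τ) {c : B}
    (hc : c ∈ Subalgebra.center F B) (hcc : c * c = 0) : c = 0 := by
  have hinj : ∀ r : F, ∀ k : ℕ, algebraMap F B r ^ k = 0 → r = 0 := by
    intro r k hr
    rw [← map_pow, map_eq_zero_iff _ (algebraMap F B).injective] at hr
    exact IsNilpotent.eq_zero ⟨k, hr⟩
  rcases h.mem_bot_or_span with h1 | h1
  · obtain ⟨r, rfl⟩ := Algebra.mem_bot.mp (h1 c hc)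
    rw [hinj r 2 (by rw [pow_two, hcc]), map_zero]
  have hneg : ∀ w ∈ Subalgebra.center F B, w * w = 0 → τ w = -w := by
    intro w hw hww
    have hττ : τ w * τ w = 0 := by rw [← h.isAlgInvolution.map_mul_rev, hww, map_zero]
    obtain ⟨r, hr⟩ := Algebra.mem_bot.mp (h.trace_mem w hw)
    have hcomm : τ w * w = w * τ w := Subalgebra.mem_center_iff.mp hw _
    have hr0 : r = 0 := by
      refine hinj r 3 ?_
      have h2 : (w + τ w) * (w + τ w) = w * τ w + w * τ w := by
        rw [add_mul, mul_add, mul_add, hww, hττ, hcomm]; abel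
      rw [hr, pow_succ, pow_two, h2, add_mul, mul_add, mul_assoc w, hcomm, ← mul_assoc w, hww,
        mul_assoc w, hττ]
      simp
    rw [hr0, map_zero] at hr
    exact eq_neg_of_add_eq_zero_right hr.symm
  have key : ∀ w ∈ Submodule.span F
      {w | ∃ a ∈ Subalgebra.center F B, ∃ z ∈ Subalgebra.center F B, w = a * (τ z - z)},
      c * w = 0 := by
    intro w hw
    induction hw using Submodule.span_induction with
    | mem w hw =>
      obtain ⟨a, ha, z, hz, rfl⟩ := hw
      have hcz : (c * z) * (c * z) = 0 := by
        rw [mul_assoc, ← mul_assoc z, Subalgebra.mem_center_iff.mp hc z, mul_assoc, ← mul_assoc,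
          hcc, zero_mul]
      have h2 := hneg _ (Subalgebra.mul_mem _ hc hz) hcz
      rw [h.map_mul_center c hz, hneg c hc hcc, neg_mul, neg_inj] at h2
      rw [← mul_assoc, ← Subalgebra.mem_center_iff.mp hc a, mul_assoc, mul_sub, h2, sub_self,
        mul_zero]
    | zero => rw [mul_zero]
    | add x y _ _ hx hy => rw [mul_add, hx, hy, add_zero]
    | smul r x _ hx => rw [mul_smul_comm, hx, smul_zero]
  simpa using key 1 h1

/-- A noninvertible central `c ≠ 0` has norm `c * τ c = 0`, so `c * c = T • c` with `T` its trace.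
Reducedness of the center gives `T ≠ 0`, and `T⁻¹ • c` is the idempotent. -/
theorem center_dichotomy [Nontrivial B] (h : AzumayaInvolutionData F τ) :
    (∀ c ∈ Subalgebra.center F B, c ≠ 0 → ∃ d ∈ Subalgebra.center F B, c * d = 1) ∨
      ∃ e ∈ Subalgebra.center F B, e ≠ 0 ∧ e * e = e ∧ e + τ e = 1 ∧ e * τ e = 0 := by
  refine or_iff_not_imp_left.mpr fun hnf => ?_
  push Not at hnf
  obtain ⟨c, hc, hc0, hcd⟩ := hnf
  have hτc := h.isAlgInvolution.map_mem_center hc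
  have hcomm : c * τ c = τ c * c := (Subalgebra.mem_center_iff.mp hc _).symm
  have hnorm : c * τ c = 0 := by
    obtain ⟨r, hr⟩ := Algebra.mem_bot.mp (h.mem_bot_of_fixed (Subalgebra.mul_mem _ hc hτc)
      (by rw [h.isAlgInvolution.map_mul_rev, h.isAlgInvolution.involutive]))
    by_contra h0
    have hr0 : r ≠ 0 := fun hr0 => h0 (by rw [← hr, hr0, map_zero])
    refine hcd (r⁻¹ • τ c) (Subalgebra.smul_mem _ hτc _) ?_
    rw [mul_smul_comm, ← hr, Algebra.algebraMap_eq_smul_one, smul_smul, inv_mul_cancel₀ hr0,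
      one_smul]
  obtain ⟨T, hT⟩ := Algebra.mem_bot.mp (h.trace_mem c hc)
  have hcT : c * c = T • c := by
    have : c * (c + τ c) = T • c := by
      rw [← hT, Algebra.algebraMap_eq_smul_one, mul_smul_comm, mul_one]
    rwa [mul_add, hnorm, add_zero] at this
  have hT0 : T ≠ 0 := by
    rintro rfl
    exact hc0 (h.eq_zero_of_mul_self hc (by rw [hcT, zero_smul]))
  refine ⟨T⁻¹ • c, Subalgebra.smul_mem _ hc _, smul_ne_zero (inv_ne_zero hT0) hc0, ?_, ?_, ?_⟩
  · rw [smul_mul_smul_comm, hcT, smul_smul, mul_assoc, inv_mul_cancel₀ hT0, mul_one]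
  · rw [map_smul, ← smul_add, ← hT, Algebra.algebraMap_eq_smul_one, smul_smul,
      inv_mul_cancel₀ hT0, one_smul]
  · rw [map_smul, smul_mul_smul_comm, hnorm, smul_zero]

/-- Sandwich maps preserve two-sided ideals, so the dual-basis coordinates of an element of `I` are
central elements of `I`. -/
theorem eq_bot_of_inf_center (h : AzumayaInvolutionData F τ) (I : Ideal B) [I.IsTwoSided]
    (hI : ∀ z ∈ Subalgebra.center F B, z ∈ I → z = 0) : I = ⊥ := by
  obtain ⟨n, b, π, hπ, hπc, hb⟩ := h.exists_dualBasis
  refine (Submodule.eq_bot_iff I).mpr fun x hx => ?_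
  rw [hb x]
  refine Finset.sum_eq_zero fun i _ => ?_
  rw [hI _ (hπc i x) (sandwichMaps_apply_mem (hπ i) (I.restrictScalars F) (fun x y b hb =>
    I.mul_mem_right _ (I.mul_mem_left _ hb)) hx), zero_mul]

theorem isSimpleRing [Nontrivial B] (h : AzumayaInvolutionData F τ)
    (hf : ∀ c ∈ Subalgebra.center F B, c ≠ 0 → ∃ d ∈ Subalgebra.center F B, c * d = 1) :
    IsSimpleRing B := by
  refine isSimpleRing_iff_isTwoSided_imp.mpr ⟨inferInstance, fun I hI => ?_⟩
  by_cases hz : ∀ z ∈ Subalgebra.center F B, z ∈ I → z = 0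
  · exact Or.inl (h.eq_bot_of_inf_center I hz)
  · push Not at hz
    obtain ⟨z, hz, hzI, hz0⟩ := hz
    obtain ⟨d, hd, hzd⟩ := hf z hz hz0
    refine Or.inr ((Ideal.eq_top_iff_one I).mpr ?_)
    rw [← hzd]
    exact I.mul_mem_right _ hzI

/-- The case of an exchange involution. -/
theorem exists_adjoin_eq_top_of_idempotent (h : AzumayaInvolutionData F τ)
    (hF : Finite F ∨ IsAlgClosed F) {e : B} (he : e ∈ Subalgebra.center F B) (he0 : e ≠ 0)
    (hee : e * e = e) (heτ : e + τ e = 1) (heτ0 : e * τ e = 0) :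
    ∃ x : B, Algebra.adjoin F {x, τ x} = ⊤ := by
  have := h.finite
  have hinv := h.isAlgInvolution
  have hecomm : ∀ b, b * e = e * b := fun b => Subalgebra.mem_center_iff.mp he b
  let I : Ideal B :=
    { carrier := {x | e * x = 0}
      add_mem' := fun {x y} (hx : e * x = 0) (hy : e * y = 0) => by
        change e * (x + y) = 0
        rw [mul_add, hx, hy, add_zero]
      zero_mem' := mul_zero e
      smul_mem' := fun b x (hx : e * x = 0) => by
        change e * (b * x) = 0
        rw [← mul_assoc, ← hecomm, mul_assoc, hx, mul_zero] }
  have hmemI : ∀ x, x ∈ I ↔ e * x = 0 := fun x => Iff.rfl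
  have hIt : I.IsTwoSided := ⟨fun {a} b ha => by
    rw [hmemI] at ha ⊢
    rw [← mul_assoc, ha, zero_mul]⟩
  have h1I : (1 : B) ∉ I := fun h1 => he0 (by rw [hmemI, mul_one] at h1; exact h1)
  -- The trace of `z * e` is a scalar, and multiplying it by `e` kills the conjugate summand.
  have hce : ∀ z ∈ Subalgebra.center F B, ∃ r : F, z * e = r • e := by
    intro z hz
    obtain ⟨r, hr⟩ := Algebra.mem_bot.mp (h.trace_mem _ (Subalgebra.mul_mem _ hz he))
    refine ⟨r, ?_⟩
    have h1 := congr_arg (e * ·) hr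
    change e * algebraMap F B r = e * (z * e + τ (z * e)) at h1
    rw [hinv.map_mul_rev, mul_add, ← mul_assoc e (τ e), heτ0, zero_mul, add_zero, ← mul_assoc,
      ← hecomm z, mul_assoc, hee, Algebra.algebraMap_eq_smul_one, mul_smul_comm, mul_one] at h1
    exact h1.symm
  let p : B →ₐ[F] B ⧸ I := Ideal.Quotient.mkₐ F I
  have hp : Function.Surjective p := Ideal.Quotient.mkₐ_surjective F I
  have hpz : ∀ x, p x = 0 ↔ e * x = 0 := fun x =>
    (Ideal.Quotient.eq_zero_iff_mem (I := I)).trans (hmemI x)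
  have hpe : p e = 1 := by
    rw [← sub_eq_zero, ← map_one p, ← map_sub, hpz, mul_sub, hee, mul_one, sub_self]
  have hpτe : p (τ e) = 0 := by rw [hpz, heτ0]
  have hnt : Nontrivial (B ⧸ I) := by
    refine ⟨1, 0, fun h10 => h1I ?_⟩
    rw [← map_one p, hpz] at h10
    exact h10
  have hsimple : IsSimpleRing (B ⧸ I) := by
    refine isSimpleRing_iff_isTwoSided_imp.mpr ⟨hnt, fun J hJ => ?_⟩
    by_cases heJ : p e ∈ J
    · right
      rwa [Ideal.eq_top_iff_one, ← hpe]
    · left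
      refine (Submodule.eq_bot_iff J).mpr fun y hy => ?_
      obtain ⟨x, rfl⟩ := hp y
      -- The quotient `B ⧸ I` is a copy of `e B`, and `I'` is the ideal of `B` inside `e B`
      -- corresponding to `J`.
      let I' : Ideal B :=
        { carrier := {w | p w ∈ J ∧ e * w = w}
          add_mem' := fun {v w} hv hw => by
            refine ⟨?_, ?_⟩
            · rw [map_add]; exact J.add_mem hv.1 hw.1
            · rw [mul_add, hv.2, hw.2]
          zero_mem' := ⟨by rw [map_zero]; exact J.zero_mem, mul_zero e⟩
          smul_mem' := fun b w hw => by
            refine ⟨?_, ?_⟩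
            · rw [smul_eq_mul, map_mul]; exact J.mul_mem_left _ hw.1
            · rw [smul_eq_mul, ← mul_assoc, ← hecomm, mul_assoc, hw.2] }
      have hI't : I'.IsTwoSided := ⟨fun {a} b ha => by
        refine ⟨?_, ?_⟩
        · rw [map_mul]; exact J.mul_mem_right _ ha.1
        · rw [← mul_assoc, ha.2]⟩
      have hI' : I' = ⊥ := by
        refine h.eq_bot_of_inf_center I' fun z hz hzI => ?_
        obtain ⟨r, hr⟩ := hce z hz
        have hzr : z = r • e := by rw [← hr, hecomm, hzI.2]
        by_contra hz0
        have hr0 : r ≠ 0 := fun hr0 => hz0 (by rw [hzr, hr0, zero_smul])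
        refine heJ ?_
        have : p e = algebraMap F _ r⁻¹ * p z := by
          rw [hzr, map_smul, ← Algebra.smul_def, smul_smul, inv_mul_cancel₀ hr0, one_smul]
        rw [this]
        exact J.mul_mem_left _ hzI.1
      have hex : e * x ∈ I' := ⟨by rw [map_mul]; exact J.mul_mem_left _ hy,
        by rw [← mul_assoc, hee]⟩
      rw [hI'] at hex
      exact (hpz x).mpr hex
  obtain ⟨π, hπ, hπc, hπ1⟩ := h.exists_retraction
  have hcenter : ∀ a ∈ Subalgebra.center F (B ⧸ I), a ∈ (⊥ : Subalgebra F (B ⧸ I)) := by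
    intro a ha
    obtain ⟨b, rfl⟩ := hp a
    -- Applied to `π` this shows that a central class `p b` equals `p (π b)`, and `π b` is central
    -- in `B`.
    have hpf : ∀ f ∈ sandwichMaps F B, p (f b) = p b * p (f 1) := by
      intro f hf
      induction hf using Submodule.span_induction with
      | mem f hf =>
        obtain ⟨⟨x, y⟩, rfl⟩ := hf
        simp only [LinearMap.mulLeftRight_apply, map_mul, mul_one]
        rw [Subalgebra.mem_center_iff.mp ha (p x), mul_assoc]
      | zero => simp
      | add f g _ _ hf hg => simp [hf, hg, mul_add]
      | smul r f _ hf => simp [hf]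
    obtain ⟨r, hr⟩ := hce _ (hπc b)
    refine Algebra.mem_bot.mpr ⟨r, ?_⟩
    have h1 := hpf π hπ
    rw [hπ1, map_one, mul_one] at h1
    have h2 := congr_arg p hr
    rw [map_mul, hpe, mul_one, h1, map_smul, hpe] at h2
    rw [h2, Algebra.algebraMap_eq_smul_one]
  obtain ⟨n, -, ⟨φ⟩⟩ := exists_algEquiv_matrix_of_finite_or_isAlgClosed hF hcenter
  let Φ : B →ₐ[F] Matrix (Fin n) (Fin n) F := (φ : (B ⧸ I) →ₐ[F] _).comp p
  have hΦ0 : ∀ x, Φ x = 0 ↔ e * x = 0 := fun x => by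
    rw [← hpz]
    exact map_eq_zero_iff φ φ.injective
  have hΦs : Function.Surjective Φ := φ.surjective.comp hp
  -- The transpose makes the second projection multiplicative. Under `(Φ, Ψ)` the involution becomes
  -- `(P, Q) ↦ (Qᵀ, Pᵀ)`.
  let Ψ : B →ₐ[F] Matrix (Fin n) (Fin n) F := AlgHom.ofLinearMap
    { toFun := fun x => (Φ (τ x))ᵀ
      map_add' := fun x y => by rw [map_add, map_add, Matrix.transpose_add]
      map_smul' := fun r x => by rw [map_smul, map_smul, Matrix.transpose_smul]; rfl }
    (by change (Φ (τ 1))ᵀ = 1; rw [hinv.map_one, map_one, Matrix.transpose_one])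
    (fun x y => by
      change (Φ (τ (x * y)))ᵀ = (Φ (τ x))ᵀ * (Φ (τ y))ᵀ
      rw [hinv.map_mul_rev, map_mul, Matrix.transpose_mul])
  have hΦe : Φ e = 1 := by
    rw [← sub_eq_zero, ← map_one Φ, ← map_sub, hΦ0, mul_sub, hee, mul_one, sub_self]
  have hΦτe : Φ (τ e) = 0 := by rw [hΦ0, heτ0]
  have hbij : Function.Bijective (Φ.prod Ψ) := by
    constructor
    · refine (injective_iff_map_eq_zero _).mpr fun x hx => ?_
      have h1 : Φ x = 0 := congr_arg Prod.fst hx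
      have h2 : Φ (τ x) = 0 := Matrix.transpose_eq_zero.mp (congr_arg Prod.snd hx)
      rw [hΦ0] at h1 h2
      have h3 : x * τ e = 0 := by
        rw [← hinv.involutive x, ← hinv.map_mul_rev, h2, map_zero]
      rw [← mul_one x, ← heτ, mul_add, h3, hecomm, h1, add_zero]
    · rintro ⟨P, Q⟩
      obtain ⟨a, ha⟩ := hΦs P
      obtain ⟨b, hb⟩ := hΦs Qᵀ
      refine ⟨e * a + τ (e * b), Prod.ext ?_ ?_⟩
      · change Φ (e * a + τ (e * b)) = P
        rw [hinv.map_mul_rev, map_add, map_mul, map_mul, hΦe, hΦτe, one_mul, mul_zero, add_zero, ha]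
      · change (Φ (τ (e * a + τ (e * b))))ᵀ = Q
        rw [map_add, hinv.involutive, hinv.map_mul_rev, map_add, map_mul, map_mul, hΦe, hΦτe,
          one_mul, mul_zero, zero_add, hb, Matrix.transpose_transpose]
  let E : B ≃ₐ[F] Matrix (Fin n) (Fin n) F × Matrix (Fin n) (Fin n) F :=
    AlgEquiv.ofBijective (Φ.prod Ψ) hbij
  have hE : ∀ x, E x = (Φ x, (Φ (τ x))ᵀ) := fun _ => rfl
  have key := Algebra.adjoin_pair_eq_top_of_surjective
    (E.symm : Matrix (Fin n) (Fin n) F × Matrix (Fin n) (Fin n) F →ₐ[F] B) E.symm.surjective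
    (Matrix.adjoin_exchange_eq_top (n := n) (C := F))
  refine ⟨E.symm (Matrix.shift n F, (Matrix.lastRowOnes n F)ᵀ), ?_⟩
  have hτ : τ (E.symm (Matrix.shift n F, (Matrix.lastRowOnes n F)ᵀ)) =
      E.symm (Matrix.lastRowOnes n F, (Matrix.shift n F)ᵀ) := by
    apply E.injective
    have h1 := hE (E.symm (Matrix.shift n F, (Matrix.lastRowOnes n F)ᵀ))
    rw [AlgEquiv.apply_symm_apply, Prod.mk.injEq] at h1
    rw [AlgEquiv.apply_symm_apply, hE, hinv.involutive, ← h1.1,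
      ← Matrix.transpose_transpose (Φ (τ _)), ← h1.2, Matrix.transpose_transpose]
  rw [hτ]
  exact key

end AzumayaInvolutionData

/-- Involutions of the second kind over finite fields. -/
theorem exists_adjoin_eq_top_of_unitary {F C B : Type*} [Field F] [Field C] [Finite C] [Ring B]
    [Algebra F C] [Algebra F B] [Algebra C B] [IsScalarTower F C B] [IsSimpleRing B]
    [Module.Finite C B] (hc : ∀ b ∈ Subalgebra.center C B, b ∈ (⊥ : Subalgebra C B))
    {τ : B →ₗ[F] B} (hinv : IsAlgInvolution F τ) (σ : C →+* C)
    (hσ : ∀ c, τ (algebraMap C B c) = algebraMap C B (σ c)) (hσ1 : ∃ c, σ c ≠ c)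
    (hfix : ∀ c, σ c = c → c ∈ Set.range (algebraMap F C)) :
    ∃ x : B, Algebra.adjoin F {x, τ x} = ⊤ := by
  obtain ⟨n, hn, ⟨φ⟩⟩ := exists_algEquiv_matrix_of_finite_or_isAlgClosed (Or.inl ‹Finite C›) hc
  have hσσ : ∀ c, σ (σ c) = c := fun c => (algebraMap C B).injective (by
    rw [← hσ, ← hσ, hinv.involutive])
  obtain ⟨θ, hθ⟩ := hσ1
  have hθ0 : σ θ - θ ≠ 0 := sub_ne_zero.mpr hθ
  -- Solving `z = a + b * θ` and `σ z = a + b * σ θ` gives `σ`-fixed coefficients, which lie in `F`.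
  have hadj : Algebra.adjoin F {θ} = ⊤ := by
    refine Algebra.eq_top_iff.mpr fun z => ?_
    obtain ⟨b, hb⟩ := hfix ((σ z - z) / (σ θ - θ)) (by
      rw [map_div₀, map_sub, map_sub, hσσ, hσσ, ← neg_sub (σ z), ← neg_sub (σ θ), neg_div_neg_eq])
    obtain ⟨a, ha⟩ := hfix (z - (σ z - z) / (σ θ - θ) * θ) (by
      rw [map_sub, map_mul, map_div₀, map_sub, map_sub, hσσ, hσσ, ← neg_sub (σ z),
        ← neg_sub (σ θ), neg_div_neg_eq]
      field_simp
      ring)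
    have hz : z = algebraMap F C a + algebraMap F C b * θ := by rw [ha, hb]; ring
    rw [hz]
    exact Subalgebra.add_mem _ (Subalgebra.algebraMap_mem _ _)
      (Subalgebra.mul_mem _ (Subalgebra.algebraMap_mem _ _) (Algebra.subset_adjoin rfl))
  let _ : StarRing C :=
    { star := σ
      star_involutive := hσσ
      star_mul := fun a b => by
        change σ (a * b) = σ b * σ a
        rw [map_mul, mul_comm]
      star_add := fun a b => map_add σ a b }
  have hstar : Matrix.IsStarInvolution (C := C) (fun x => φ (τ (φ.symm x))) := by
    refine ⟨fun x y => ?_, fun c x => ?_, fun x y => ?_, fun x => ?_⟩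
    · rw [map_add, map_add, map_add]
    · rw [map_smul, Algebra.smul_def c (φ.symm x), hinv.map_mul_rev, hσ, ← Algebra.commutes,
        ← Algebra.smul_def, map_smul]
      rfl
    · rw [map_mul, hinv.map_mul_rev, map_mul]
    · rw [AlgEquiv.symm_apply_apply, hinv.involutive, AlgEquiv.apply_symm_apply]
  obtain ⟨g, hg, hh, hna, hform⟩ := hstar.exists_hermitian hn ⟨θ, hθ⟩
  obtain ⟨x, hx⟩ := Matrix.exists_adjoin_adjoint_eq_top_of_hermitian (F := F) θ hadj
    (Or.inr inferInstance) hg hh hna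
  rw [← hform] at hx
  refine ⟨φ.symm x, ?_⟩
  have := Algebra.adjoin_pair_eq_top_of_surjective
    ((φ.symm.restrictScalars F : Matrix (Fin n) (Fin n) C ≃ₐ[F] B) : _ →ₐ[F] B)
    φ.symm.surjective hx
  have hτ : τ (φ.symm x) = φ.symm (φ (τ (φ.symm x))) := (φ.symm_apply_apply _).symm
  rw [hτ]
  exact this

namespace AzumayaInvolutionData

/-- The generation theorem over finite and algebraically closed fields. -/
theorem exists_adjoin_eq_top_or_symplectic {F B : Type*} [Field F] [Ring B] [Algebra F B]
    {τ : B →ₗ[F] B} (h : AzumayaInvolutionData F τ) (hF : Finite F ∨ IsAlgClosed F) :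
    (∃ x : B, Algebra.adjoin F {x, τ x} = ⊤) ∨
      ((∀ z ∈ Subalgebra.center F B, z ∈ (⊥ : Subalgebra F B)) ∧
        ∃ (φ : B ≃ₐ[F] Matrix (Fin 2) (Fin 2) F) (g : Matrix (Fin 2) (Fin 2) F),
        IsUnit g ∧ gᵀ = -g ∧ (∀ i, g i i = 0) ∧ ∀ x, φ (τ x) = g⁻¹ * (φ x)ᵀ * g) := by
  rcases subsingleton_or_nontrivial B with hB | hB
  · exact Or.inl ⟨0, Subsingleton.elim _ _⟩
  have hinv := h.isAlgInvolution
  have := h.finite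
  rcases h.center_dichotomy with hfield | ⟨e, he, he0, hee, heτ, heτ0⟩
  swap
  · exact Or.inl (h.exists_adjoin_eq_top_of_idempotent hF he he0 hee heτ heτ0)
  have := h.isSimpleRing hfield
  by_cases hbot : ∀ z ∈ Subalgebra.center F B, z ∈ (⊥ : Subalgebra F B)
  · obtain ⟨n, hn, ⟨φ⟩⟩ := exists_algEquiv_matrix_of_finite_or_isAlgClosed hF hbot
    rcases Matrix.exists_adjoin_eq_top_or_symplectic hn
      (φ.toLinearMap ∘ₗ τ ∘ₗ φ.symm.toLinearMap)
      (fun x y => by simp [hinv.map_mul_rev]) (fun x => by simp [hinv.involutive])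
      with ⟨x, hx⟩ | ⟨rfl, g, hg, hgt, hgd, hform⟩
    · left
      refine ⟨φ.symm x, ?_⟩
      have := Algebra.adjoin_pair_eq_top_of_surjective
        (φ.symm : Matrix (Fin n) (Fin n) F →ₐ[F] B) φ.symm.surjective hx
      have hτ : τ (φ.symm x) =
          φ.symm ((φ.toLinearMap ∘ₗ τ ∘ₗ φ.symm.toLinearMap) x) := (φ.symm_apply_apply _).symm
      rw [hτ]
      exact this
    · right
      refine ⟨hbot, φ, g, hg, hgt, hgd, fun x => ?_⟩
      have := hform (φ x)
      simpa using this
  · left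
    push Not at hbot
    obtain ⟨c₀, hc₀, hc₀b⟩ := hbot
    have hC : IsField (Subalgebra.center F B) :=
      { exists_pair_ne := ⟨0, 1, zero_ne_one⟩
        mul_comm := mul_comm
        mul_inv_cancel := fun {a} ha => by
          obtain ⟨d, hd, had⟩ := hfield a a.2 (fun h0 => ha (Subtype.ext h0))
          exact ⟨⟨d, hd⟩, Subtype.ext had⟩ }
    let _ : Field (Subalgebra.center F B) := hC.toField
    have hfinC : Module.Finite F (Subalgebra.center F B) :=
      inferInstanceAs (Module.Finite F (Subalgebra.toSubmodule (Subalgebra.center F B)))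
    rcases hF with hF | hF
    · have hfinite : Finite (Subalgebra.center F B) := Module.finite_of_finite F
      have htower : IsScalarTower F (Subalgebra.center F B) B := ⟨fun r z b => by
        rw [Algebra.smul_def (z : Subalgebra.center F B), Algebra.smul_def (r • z)]
        exact smul_mul_assoc r (z : B) b⟩
      have : Module.Finite (Subalgebra.center F B) B :=
        Module.Finite.of_restrictScalars_finite F _ _
      refine exists_adjoin_eq_top_of_unitary (C := Subalgebra.center F B) ?_ hinv
        (centerInvolution hinv).toRingHom (fun c => rfl) ?_ ?_
      · intro b hb
        exact Algebra.mem_bot.mpr ⟨⟨b, Subalgebra.mem_center_iff.mpr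
          (Subalgebra.mem_center_iff.mp hb)⟩, rfl⟩
      · refine ⟨⟨c₀, hc₀⟩, fun h0 => hc₀b (h.mem_bot_of_fixed hc₀ (congr_arg Subtype.val h0))⟩
      · intro c h0
        obtain ⟨r, hr⟩ := Algebra.mem_bot.mp (h.mem_bot_of_fixed c.2 (congr_arg Subtype.val h0))
        exact ⟨r, Subtype.ext hr⟩
    -- An algebraically closed field has no proper finite extension that could serve as center.
    · exfalso
      obtain ⟨r, hr⟩ := (IsAlgClosed.algebraMap_bijective_of_isIntegral
        (k := F) (K := Subalgebra.center F B)).2 ⟨c₀, hc₀⟩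
      exact hc₀b (Algebra.mem_bot.mpr ⟨r, congr_arg Subtype.val hr⟩)

end AzumayaInvolutionData

/-! ### Descent of a single generator along a field extension. -/

section descent

variable {E : Type*} [Ring E]

/-- Evaluation of noncommutative words in two letters. -/
def wordEval (x y : E) : FreeMonoid Bool →* E := FreeMonoid.lift fun b => cond b x y

theorem map_wordEval {E' : Type*} [Ring E'] (f : E →+* E') (x y : E) (w : FreeMonoid Bool) :
    f (wordEval x y w) = wordEval (f x) (f y) w := by
  have : (f : E →* E').comp (wordEval x y) = wordEval (f x) (f y) := by
    ext b
    cases b <;> simp [wordEval]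
  exact DFunLike.congr_fun this w

theorem adjoin_pair_eq_top_iff_span_wordEval {F : Type*} [CommRing F] [Algebra F E] (x y : E) :
    Algebra.adjoin F {x, y} = ⊤ ↔ Submodule.span F (Set.range (wordEval x y)) = ⊤ := by
  have hrange : Set.range (fun b : Bool => cond b x y) = {x, y} := by
    ext z
    simp [eq_comm, or_comm]
  have h : Subalgebra.toSubmodule (Algebra.adjoin F {x, y}) =
      Submodule.span F (Set.range (wordEval x y)) := by
    rw [Algebra.adjoin_eq_span, ← hrange, ← FreeMonoid.mrange_lift, MonoidHom.coe_mrange]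
    rfl
  rw [← h, Algebra.toSubmodule_eq_top]

variable {K : Type*} [Field K] {B : Type*} [Ring B] [Algebra K B] {ι : Type*}

theorem baseChange_repr_map (b : Module.Basis ι K B) {L L' : Type*} [CommRing L] [Algebra K L]
    [CommRing L'] [Algebra K L'] (f : L →ₐ[K] L') (z : L ⊗[K] B) (i : ι) :
    (b.baseChange L').repr (Algebra.TensorProduct.map f (AlgHom.id K B) z) i =
      f ((b.baseChange L).repr z i) := by
  induction z with
  | zero => simp
  | add x y hx hy => simp only [map_add, Finsupp.add_apply, hx, hy]
  | tmul a c => simp [Module.Basis.baseChange_repr_tmul]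

theorem map_baseChange_apply (τ : B →ₗ[K] B) {L L' : Type*} [CommRing L] [Algebra K L]
    [CommRing L'] [Algebra K L'] (f : L →ₐ[K] L') (z : L ⊗[K] B) :
    Algebra.TensorProduct.map f (AlgHom.id K B) (τ.baseChange L z) =
      τ.baseChange L' (Algebra.TensorProduct.map f (AlgHom.id K B) z) := by
  induction z with
  | zero => simp
  | add x y hx hy => simp only [map_add, hx, hy]
  | tmul a c => simp

/-- The element whose coordinates are indeterminates. -/
noncomputable def genericElement [Fintype ι] (b : Module.Basis ι K B) : MvPolynomial ι K ⊗[K] B :=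
  ∑ i, MvPolynomial.X i ⊗ₜ b i

/-- The determinant of a family of words in the generic element and its conjugate. -/
noncomputable def genericDet [Fintype ι] [DecidableEq ι] (b : Module.Basis ι K B) (τ : B →ₗ[K] B)
    (w : ι → FreeMonoid Bool) : MvPolynomial ι K :=
  ((b.baseChange (MvPolynomial ι K)).toMatrix fun j =>
    wordEval (genericElement b) (τ.baseChange _ (genericElement b)) (w j)).det

theorem aeval_genericDet [Fintype ι] [DecidableEq ι] (b : Module.Basis ι K B) (τ : B →ₗ[K] B)
    (w : ι → FreeMonoid Bool) (L : Type*) [CommRing L] [Algebra K L] (u : ι → L) (x : L ⊗[K] B)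
    (hx : x = ∑ i, u i ⊗ₜ b i) :
    MvPolynomial.aeval u (genericDet b τ w) =
      (b.baseChange L).det fun j => wordEval x (τ.baseChange L x) (w j) := by
  have hspec : Algebra.TensorProduct.map (MvPolynomial.aeval u) (AlgHom.id K B)
      (genericElement b) = x := by
    simp [genericElement, hx]
  rw [genericDet, AlgHom.map_det, Module.Basis.det_apply]
  congr 1
  ext i j
  rw [AlgHom.mapMatrix_apply, Matrix.map_apply, Module.Basis.toMatrix_apply,
    Module.Basis.toMatrix_apply, ← baseChange_repr_map]
  have := map_wordEval (Algebra.TensorProduct.map (MvPolynomial.aeval u : _ →ₐ[K] L)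
    (AlgHom.id K B) : _ →+* L ⊗[K] B) (genericElement b) (τ.baseChange _ (genericElement b)) (w j)
  rw [RingHom.coe_coe, map_baseChange_apply, hspec] at this
  rw [this]

theorem lid_baseChange_apply (τ : B →ₗ[K] B) (x : K ⊗[K] B) :
    Algebra.TensorProduct.lid K B (τ.baseChange K x) = τ (Algebra.TensorProduct.lid K B x) := by
  induction x with
  | zero => simp
  | add x y hx hy => simp only [map_add, hx, hy]
  | tmul a c => simp

/-- Over an infinite field, the existence of a single generator can be tested after a field
extension. -/
theorem exists_adjoin_eq_top_of_baseChange [Infinite K] [Module.Finite K B] (τ : B →ₗ[K] B)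
    (F : Type*) [Field F] [Algebra K F] (x₀ : F ⊗[K] B)
    (h : Algebra.adjoin F {x₀, τ.baseChange F x₀} = ⊤) :
    ∃ x : B, Algebra.adjoin K {x, τ x} = ⊤ := by
  classical
  let b := Module.finBasis K B
  rw [adjoin_pair_eq_top_iff_span_wordEval] at h
  -- Words in `x₀` and its conjugate span, so some of them form a basis; the determinant of these
  -- words is the polynomial to be kept nonzero.
  obtain ⟨κ, a, -, hspan, hli⟩ := exists_linearIndependent' F
    (wordEval x₀ (τ.baseChange F x₀))
  rw [h] at hspan
  let c : Module.Basis κ F (F ⊗[K] B) := Module.Basis.mk hli hspan.ge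
  let e := (b.baseChange F).indexEquiv c
  have hdet : IsUnit ((b.baseChange F).det fun j =>
      wordEval x₀ (τ.baseChange F x₀) (a (e j))) := by
    refine (Module.Basis.is_basis_iff_det _).mp ⟨hli.comp e e.injective, ?_⟩
    have := e.surjective.range_comp (wordEval x₀ (τ.baseChange F x₀) ∘ a)
    rw [← hspan, ← this]
    rfl
  have hx₀ : x₀ = ∑ i, (b.baseChange F).repr x₀ i ⊗ₜ b i := by
    conv_lhs => rw [← (b.baseChange F).sum_repr x₀]
    refine Finset.sum_congr rfl fun i _ => ?_
    rw [Module.Basis.baseChange_apply, TensorProduct.smul_tmul', smul_eq_mul, mul_one]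
  rw [← aeval_genericDet b τ (fun j => a (e j)) F _ x₀ hx₀] at hdet
  -- The polynomial has coefficients in `K` and is nonzero at an `F`-point; as `K` is infinite, it
  -- is nonzero at a `K`-point.
  obtain ⟨u, hu⟩ : ∃ u : Fin (Module.finrank K B) → K,
      MvPolynomial.eval u (genericDet b τ fun j => a (e j)) ≠ 0 := by
    by_contra! h0
    have : genericDet b τ (fun j => a (e j)) = 0 := MvPolynomial.funext fun u => by
      rw [h0, map_zero]
    rw [this, map_zero] at hdet
    exact not_isUnit_zero hdet
  rw [← MvPolynomial.coe_aeval_eq_eval, RingHom.coe_coe,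
    aeval_genericDet b τ (fun j => a (e j)) K u _ rfl] at hu
  have h1 := ((Module.Basis.is_basis_iff_det _).mpr (isUnit_iff_ne_zero.mpr hu)).2
  set x := ∑ i, u i ⊗ₜ[K] b i
  have h2 : Algebra.adjoin K {x, τ.baseChange K x} = ⊤ := by
    rw [adjoin_pair_eq_top_iff_span_wordEval, eq_top_iff, ← h1]
    refine Submodule.span_mono ?_
    rintro _ ⟨j, rfl⟩
    exact ⟨_, rfl⟩
  refine ⟨Algebra.TensorProduct.lid K B x, ?_⟩
  rw [← lid_baseChange_apply]
  exact Algebra.adjoin_pair_eq_top_of_surjective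
    (Algebra.TensorProduct.lid K B : K ⊗[K] B →ₐ[K] B) (Algebra.TensorProduct.lid K B).surjective h2

end descent

/-! ### Arbitrary residue fields. -/

section residueField

variable {K : Type u} {A : Type v} [Field K] [Ring A] [Algebra K A] {τ : A →ₗ[K] A}

/-- The dimension is unchanged by extension. A central `z` becomes a scalar over `F`, so it is fixed
by `τ` and hence lies in `K`. -/
theorem AzumayaInvolutionData.isSymplecticCentralSimple (h : AzumayaInvolutionData K τ)
    (F : Type u) [Field F] [Algebra K F]
    (hc : ∀ z ∈ Subalgebra.center F (F ⊗[K] A), z ∈ (⊥ : Subalgebra F (F ⊗[K] A)))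
    (φ : F ⊗[K] A ≃ₐ[F] Matrix (Fin 2) (Fin 2) F) (g : Matrix (Fin 2) (Fin 2) F)
    (hg : IsUnit g) (hgt : gᵀ = -g) (hgd : ∀ i, g i i = 0)
    (hφ : ∀ x, φ (τ.baseChange F x) = g⁻¹ * (φ x)ᵀ * g) :
    IsSymplecticCentralSimple K 2 τ := by
  have hrank : Module.finrank K A = 2 ^ 2 := by
    rw [← Module.finrank_baseChange (R := F), φ.toLinearEquiv.finrank_eq, Module.finrank_matrix]
    simp
  have hnt : Nontrivial A := Module.nontrivial_of_finrank_pos (R := K) (by rw [hrank]; norm_num)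
  have hcenter : ∀ z ∈ Subalgebra.center K A, z ∈ (⊥ : Subalgebra K A) := by
    intro z hz
    refine h.mem_bot_of_fixed hz ?_
    obtain ⟨r, hr⟩ := Algebra.mem_bot.mp (hc _ (one_tmul_mem_center F hz))
    have h1 : τ.baseChange F (1 ⊗ₜ z) = 1 ⊗ₜ z := by
      rw [← hr, Algebra.algebraMap_eq_smul_one, map_smul,
        (h.isAlgInvolution.baseChange F).map_one]
    rw [LinearMap.baseChange_tmul] at h1
    exact Algebra.TensorProduct.includeRight_injective (R := K) (A := F) (B := A)
      (algebraMap K F).injective h1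
  refine ⟨⟨hcenter⟩, h.isSimpleRing fun c hc hc0 => ?_, h.finite, hrank, h.isAlgInvolution,
    F, inferInstance, inferInstance, φ, g, hg, hgt, hgd, hφ⟩
  obtain ⟨r, rfl⟩ := Algebra.mem_bot.mp (hcenter c hc)
  have hr0 : r ≠ 0 := fun hr0 => hc0 (by rw [hr0, map_zero])
  exact ⟨algebraMap K A r⁻¹, Subalgebra.algebraMap_mem _ _, by
    rw [← map_mul, mul_inv_cancel₀ hr0, map_one]⟩

/-- Over any field, a single element generates, except in the symplectic case of degree two. -/
theorem AzumayaInvolutionData.exists_adjoin_eq_top (h : AzumayaInvolutionData K τ)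
    (hns : ¬ IsSymplecticCentralSimple K 2 τ) : ∃ x : A, Algebra.adjoin K {x, τ x} = ⊤ := by
  have := h.finite
  rcases finite_or_infinite K with hK | hK
  · rcases (h.baseChange K).exists_adjoin_eq_top_or_symplectic (Or.inl hK) with
      ⟨x, hx⟩ | ⟨hc, φ, g, hg, hgt, hgd, hφ⟩
    · refine ⟨Algebra.TensorProduct.lid K A x, ?_⟩
      rw [← lid_baseChange_apply]
      exact Algebra.adjoin_pair_eq_top_of_surjective
        (Algebra.TensorProduct.lid K A : K ⊗[K] A →ₐ[K] A)
        (Algebra.TensorProduct.lid K A).surjective hx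
    · exact absurd (h.isSymplecticCentralSimple K hc φ g hg hgt hgd hφ) hns
  · rcases (h.baseChange (AlgebraicClosure K)).exists_adjoin_eq_top_or_symplectic
      (Or.inr inferInstance) with ⟨x, hx⟩ | ⟨hc, φ, g, hg, hgt, hgd, hφ⟩
    · exact exists_adjoin_eq_top_of_baseChange τ (AlgebraicClosure K) x hx
    · exact absurd (h.isSymplecticCentralSimple _ hc φ g hg hgt hgd hφ) hns

end residueField

/-! ### Passing from fibres to the ring. -/

section invAdjoin

variable {R : Type u} {B : Type v} [CommRing R] [Ring B] [Algebra R B] {τ : B →ₗ[R] B}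

/-- The subalgebra with involution generated by `s`. -/
def invAdjoin (τ : B →ₗ[R] B) (s : Set B) : Subalgebra R B := Algebra.adjoin R (s ∪ τ '' s)

theorem invAdjoin_mono {s t : Set B} (h : s ⊆ t) : invAdjoin τ s ≤ invAdjoin τ t :=
  Algebra.adjoin_mono (Set.union_subset_union h (Set.image_mono h))

theorem generatesWithInvolution_of_invAdjoin_eq_top {s : Set B} (h : invAdjoin τ s = ⊤) :
    GeneratesWithInvolution τ s := by
  intro S hs hτ
  rw [eq_top_iff, ← h]
  refine Algebra.adjoin_le (Set.union_subset hs ?_)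
  rintro _ ⟨x, hx, rfl⟩
  exact hτ x (hs hx)

/-- The maximal ideals at which `s` fails to generate. -/
def nonGeneratingLocus (τ : B →ₗ[R] B) (s : Set B) : Set (MaximalSpectrum R) :=
  {m | ∀ r : R, (∀ b, r • b ∈ invAdjoin τ s) → r ∈ m.asIdeal}

theorem isClosed_nonGeneratingLocus (s : Set B) : IsClosed (nonGeneratingLocus τ s) := by
  have : nonGeneratingLocus τ s = MaximalSpectrum.toPrimeSpectrum ⁻¹'
      PrimeSpectrum.zeroLocus {r | ∀ b, r • b ∈ invAdjoin τ s} := rfl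
  rw [this]
  exact (PrimeSpectrum.isClosed_zeroLocus _).preimage MaximalSpectrum.toPrimeSpectrum_continuous

theorem nonGeneratingLocus_anti {s t : Set B} (h : s ⊆ t) :
    nonGeneratingLocus τ t ⊆ nonGeneratingLocus τ s :=
  fun _ hm r hr => hm r fun b => invAdjoin_mono h (hr b)

theorem invAdjoin_eq_top_of_nonGeneratingLocus_eq_empty {s : Set B}
    (h : nonGeneratingLocus τ s = ∅) : invAdjoin τ s = ⊤ := by
  let J : Ideal R :=
    { carrier := {r | ∀ b, r • b ∈ invAdjoin τ s}
      add_mem' := fun {x y} hx hy b => by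
        rw [add_smul]; exact Subalgebra.add_mem _ (hx b) (hy b)
      zero_mem' := fun b => by rw [zero_smul]; exact Subalgebra.zero_mem _
      smul_mem' := fun c x hx b => by
        rw [smul_eq_mul, mul_smul]; exact Subalgebra.smul_mem _ (hx b) c }
  have hJ : J = ⊤ := by
    by_contra hJ
    obtain ⟨m, hm, hJm⟩ := Ideal.exists_le_maximal J hJ
    have : (⟨m, hm⟩ : MaximalSpectrum R) ∈ nonGeneratingLocus τ s := fun r hr => hJm hr
    rw [h] at this
    exact this
  have h1 : (1 : R) ∈ J := hJ ▸ Submodule.mem_top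
  exact Algebra.eq_top_iff.mpr fun b => by simpa using h1 b

theorem one_tmul_eq_zero_of_mem_smul {I : Ideal R} {b : B} (hb : b ∈ I • (⊤ : Submodule R B)) :
    (1 : R ⧸ I) ⊗ₜ[R] b = 0 := by
  have h := TensorProduct.quotTensorEquivQuotSMul_mk_one_tmul (M := B) I b
  rw [(Submodule.Quotient.mk_eq_zero _).mpr hb] at h
  exact (TensorProduct.quotTensorEquivQuotSMul B I).map_eq_zero_iff.mp h

theorem mem_smul_of_one_tmul_eq_zero {I : Ideal R} {b : B} (hb : (1 : R ⧸ I) ⊗ₜ[R] b = 0) :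
    b ∈ I • (⊤ : Submodule R B) := by
  have h := TensorProduct.quotTensorEquivQuotSMul_mk_one_tmul (M := B) I b
  rw [hb, map_zero] at h
  exact (Submodule.Quotient.mk_eq_zero _).mp h.symm

/-- Nakayama's lemma for generation at a maximal ideal. -/
theorem notMem_nonGeneratingLocus [Module.Finite R B] {s : Set B} (m : MaximalSpectrum R) {x b : B}
    (hx : Algebra.adjoin (R ⧸ m.asIdeal)
      {(1 : R ⧸ m.asIdeal) ⊗ₜ[R] x, τ.baseChange (R ⧸ m.asIdeal) (1 ⊗ₜ[R] x)} = ⊤)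
    (hb : b ∈ s) (hbx : b - x ∈ m.asIdeal • (⊤ : Submodule R B)) :
    m ∉ nonGeneratingLocus τ s := by
  have h1 : (1 : R ⧸ m.asIdeal) ⊗ₜ[R] x = 1 ⊗ₜ b := by
    have := one_tmul_eq_zero_of_mem_smul hbx
    rw [TensorProduct.tmul_sub, sub_eq_zero] at this
    exact this.symm
  rw [h1] at hx
  -- The image in the fibre of the subalgebra generated by `s`.
  let S : Subalgebra (R ⧸ m.asIdeal) ((R ⧸ m.asIdeal) ⊗[R] B) :=
    { carrier := {y | ∃ c ∈ invAdjoin τ s, y = 1 ⊗ₜ c}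
      mul_mem' := by
        rintro _ _ ⟨c, hc, rfl⟩ ⟨c', hc', rfl⟩
        exact ⟨c * c', Subalgebra.mul_mem _ hc hc', by simp⟩
      add_mem' := by
        rintro _ _ ⟨c, hc, rfl⟩ ⟨c', hc', rfl⟩
        exact ⟨c + c', Subalgebra.add_mem _ hc hc', by rw [TensorProduct.tmul_add]⟩
      algebraMap_mem' := fun r => by
        obtain ⟨r, rfl⟩ := Ideal.Quotient.mk_surjective r
        exact ⟨algebraMap R B r, Subalgebra.algebraMap_mem _ r,
          (one_tmul_algebraMap (R ⧸ m.asIdeal) r).symm⟩ }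
  have hS : S = ⊤ := by
    rw [eq_top_iff, ← hx]
    refine Algebra.adjoin_le ?_
    rintro _ (rfl | rfl)
    · exact ⟨b, Algebra.subset_adjoin (Or.inl hb), rfl⟩
    · exact ⟨τ b, Algebra.subset_adjoin (Or.inr ⟨b, hb, rfl⟩), by rw [LinearMap.baseChange_tmul]⟩
  have hsup : (⊤ : Submodule R B) ≤
      Subalgebra.toSubmodule (invAdjoin τ s) ⊔ m.asIdeal • ⊤ := by
    intro y _
    obtain ⟨c, hc, hyc⟩ := (hS ▸ Algebra.mem_top : (1 : R ⧸ m.asIdeal) ⊗ₜ[R] y ∈ S)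
    rw [← sub_eq_zero, ← TensorProduct.tmul_sub] at hyc
    have := Submodule.add_mem_sup 
      (show c ∈ Subalgebra.toSubmodule (invAdjoin τ s) from hc)
      (mem_smul_of_one_tmul_eq_zero hyc)
    rwa [add_sub_cancel] at this
  -- Nakayama gives `r ∈ 1 + 𝔪` with `r B` inside the generated subalgebra; membership of `m` in the
  -- locus would put `r` in `𝔪`.
  obtain ⟨r, hr, hrB⟩ := Submodule.exists_sub_one_mem_and_smul_le_of_fg_of_le_sup
    Module.Finite.fg_top le_rfl hsup
  intro hm
  have hrm : r ∈ m.asIdeal :=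
    hm r fun c => hrB (Submodule.smul_mem_pointwise_smul c r ⊤ Submodule.mem_top)
  refine m.isMaximal.ne_top ((Ideal.eq_top_iff_one _).mpr ?_)
  have := m.asIdeal.sub_mem hrm hr
  rwa [sub_sub_cancel] at this

/-- Simultaneous approximation at finitely many maximal ideals. -/
theorem exists_forall_sub_mem_smul_top (T : Set (MaximalSpectrum R)) (hT : T.Finite)
    (x : MaximalSpectrum R → B) :
    ∃ b : B, ∀ m ∈ T, b - x m ∈ m.asIdeal • (⊤ : Submodule R B) := by
  classical
  have := hT.to_subtype
  have := Fintype.ofFinite T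
  have hcop : Pairwise (Function.onFun IsCoprime fun m : T => m.1.asIdeal) := by
    intro m m' hmm'
    have := m.1.isMaximal
    have := m'.1.isMaximal
    exact Ideal.isCoprime_of_isMaximal fun h => hmm' (Subtype.ext (MaximalSpectrum.ext h))
  -- Chinese remainder theorem: `r m` is `1` modulo `m` and `0` modulo the other ideals of `T`.
  choose r hr using fun m : T => Ideal.exists_forall_sub_mem_ideal hcop (Pi.single m (1 : R))
  refine ⟨∑ m : T, r m • x m, fun m hm => ?_⟩
  have h1 : ∑ m' : T, r m' • x m' - x m =
      ∑ m' : T, (r m' - (Pi.single m' (1 : R) : T → R) ⟨m, hm⟩) • x m' := by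
    simp only [sub_smul, Finset.sum_sub_distrib]
    congr 1
    rw [Finset.sum_eq_single ⟨m, hm⟩]
    · simp
    · intro m' _ hne
      rw [Pi.single_eq_of_ne hne.symm, zero_smul]
    · simp
  rw [h1]
  exact Submodule.sum_mem _ fun m' _ =>
    Submodule.smul_mem_smul (hr m' ⟨m, hm⟩) Submodule.mem_top

end invAdjoin

open TopologicalSpace in
/-- If one element suffices at every maximal ideal, then `k` elements can be chosen such that the
irreducible closed subsets of the locus where they do not generate have coheight at least `k`. -/
theorem exists_encard_le_and_le_coheight {R : Type u} {B : Type v} [CommRing R]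
    [IsNoetherianRing R] [Ring B] [Algebra R B] [Module.Finite R B] (τ : B →ₗ[R] B)
    (hloc : ∀ m : MaximalSpectrum R, ∃ x : B, Algebra.adjoin (R ⧸ m.asIdeal)
      {(1 : R ⧸ m.asIdeal) ⊗ₜ[R] x, τ.baseChange (R ⧸ m.asIdeal) (1 ⊗ₜ[R] x)} = ⊤) (k : ℕ) :
    ∃ s : Set B, s.encard ≤ k ∧ ∀ C : IrreducibleCloseds (MaximalSpectrum R),
      (C : Set (MaximalSpectrum R)) ⊆ nonGeneratingLocus τ s → (k : ℕ∞) ≤ Order.coheight C := by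
  choose x hx using hloc
  induction k with
  | zero => exact ⟨∅, by simp, fun _ _ => by simp⟩
  | succ k ih =>
    obtain ⟨s, hs, hcoh⟩ := ih
    have : NoetherianSpace (MaximalSpectrum R) :=
      (Topology.IsInducing.mk rfl :
        Topology.IsInducing (MaximalSpectrum.toPrimeSpectrum (R := R))).noetherianSpace
    obtain ⟨Z, hZ, hZc, hZi, hZs⟩ := NoetherianSpace.exists_finite_set_isClosed_irreducible
      (isClosed_nonGeneratingLocus (τ := τ) s)
    -- One point on each irreducible component, at which the next element is made a fibre generator.
    choose p hp using fun t : Z => (hZi t t.2).nonempty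
    have := hZ.to_subtype
    obtain ⟨b, hb⟩ := exists_forall_sub_mem_smul_top (Set.range p) (Set.finite_range p) x
    refine ⟨insert b s, (Set.encard_insert_le s b).trans ?_, fun C hC => ?_⟩
    · push_cast
      gcongr
    have hCs : (C : Set (MaximalSpectrum R)) ⊆
        ⋃₀ (hZ.toFinset : Set (Set (MaximalSpectrum R))) := by
      rw [hZ.coe_toFinset, ← hZs]
      exact hC.trans (nonGeneratingLocus_anti (Set.subset_insert b s))
    obtain ⟨t, ht, hCt⟩ := isIrreducible_iff_sUnion_isClosed.mp C.isIrreducible hZ.toFinset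
      (fun z hz => hZc z (hZ.mem_toFinset.mp hz)) hCs
    rw [hZ.mem_toFinset] at ht
    let D : IrreducibleCloseds (MaximalSpectrum R) := ⟨t, hZi t ht, hZc t ht⟩
    have hDs : (D : Set (MaximalSpectrum R)) ⊆ nonGeneratingLocus τ s := by
      rw [hZs]
      exact Set.subset_sUnion_of_mem ht
    -- The chosen point of `D` is no longer in the locus, so it is missing from `C`.
    have hCD : C < D := by
      refine lt_of_le_of_ne hCt fun h => ?_
      have hpC : p ⟨t, ht⟩ ∈ (C : Set (MaximalSpectrum R)) := h ▸ hp ⟨t, ht⟩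
      exact notMem_nonGeneratingLocus (p ⟨t, ht⟩) (hx _) (Set.mem_insert b s)
        (hb _ ⟨⟨t, ht⟩, rfl⟩) (hC hpC)
    calc ((k + 1 : ℕ) : ℕ∞) = k + 1 := by push_cast; rfl
      _ ≤ Order.coheight D + 1 := by gcongr; exact hcoh D hDs
      _ ≤ Order.coheight C := Order.coheight_add_one_le hCD

theorem mainTheorem9 {R : Type u} {B : Type v} [CommRing R] [IsNoetherianRing R]
    [Ring B] [Algebra R B] (τ : B →ₗ[R] B) (hB : IsAzumayaWithInvolution R τ)
    (d : ℕ∞) (hd : topologicalKrullDim (MaximalSpectrum R) ≤ (d : WithBot ℕ∞))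
    (hns : ∀ m : MaximalSpectrum R, ¬ FiberIsSymplectic τ 2 m) :
    genWithInvolution τ ≤ d + 1 := by
  induction d using ENat.recTopCoe with
  | top => simp
  | coe n =>
    have hdata := hB.azumayaInvolutionData
    have := hdata.finite
    have hloc : ∀ m : MaximalSpectrum R, ∃ x : B, Algebra.adjoin (R ⧸ m.asIdeal)
        {(1 : R ⧸ m.asIdeal) ⊗ₜ[R] x, τ.baseChange (R ⧸ m.asIdeal) (1 ⊗ₜ[R] x)} = ⊤ := by
      intro m
      let _ : Field (R ⧸ m.asIdeal) := Ideal.Quotient.field m.asIdeal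
      obtain ⟨y, hy⟩ := (hdata.baseChange (R ⧸ m.asIdeal)).exists_adjoin_eq_top (hns m)
      obtain ⟨x, rfl⟩ := TensorProduct.mk_surjective R B (R ⧸ m.asIdeal)
        Ideal.Quotient.mk_surjective y
      exact ⟨x, hy⟩
    obtain ⟨s, hs, hcoh⟩ := exists_encard_le_and_le_coheight τ hloc (n + 1)
    have hempty : nonGeneratingLocus τ s = ∅ := by
      by_contra hne
      obtain ⟨m, hm⟩ := Set.nonempty_iff_ne_empty.mpr hne
      -- A surviving point would be an irreducible closed subset of coheight at least `n + 1` in a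
      -- space of dimension at most `n`.
      let C : TopologicalSpace.IrreducibleCloseds (MaximalSpectrum R) :=
        ⟨{m}, isIrreducible_singleton, isClosed_singleton⟩
      have h1 := hcoh C (Set.singleton_subset_iff.mpr hm)
      have h2 : ((Order.coheight C : ℕ∞) : WithBot ℕ∞) ≤ ((n : ℕ∞) : WithBot ℕ∞) :=
        (Order.coheight_le_krullDim C).trans hd
      have h3 : ((n + 1 : ℕ) : ℕ∞) ≤ (n : ℕ∞) := h1.trans (WithBot.coe_le_coe.mp h2)
      have h4 : n + 1 ≤ n := by exact_mod_cast h3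
      omega
    have hgen := generatesWithInvolution_of_invAdjoin_eq_top
      (invAdjoin_eq_top_of_nonGeneratingLocus_eq_empty hempty)
    refine (iInf₂_le s hgen).trans (hs.trans ?_)
    push_cast
    rfl
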